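/- Let $d\ge 1$ and let $\mathbb V=\bigcup_{n\ge 0}\mathbb V_n$, $\mathbb V_n=\{1,\dots,d\}^n$, be the rooted $d$-ary tree with root $\emptyset$; the edge $a(v)$ joining $v\ne\emptyset$ to its parent is indexed by $v$. A vertex $v=(v_1,\dots,v_n)$, $n\ge1$, has colour $v_n$, and the root has a fixed colour $\alpha\in\{1,\dots,d\}$. Let $\eta=(\eta_{ij})_{1\le i,j\le d}$ be a random matrix, with arbitrarily dependent integrable entries, each of which is either almost surely $0$ or almost surely strictly positive. Put $m(x)=(\mathbb E\,\eta_{ij}^x)_{i,j}$ for $x\in[0,1]$ (with $0^0=1$), and suppose that there is an integer $N$ such that all entries of $m(x)^N$ are strictly positive for every $x\in[0,1]$. Let $\rho(x)$ be the largest eigenvalue of $m(x)$ and $\lambda=\inf_{x\in[0,1]}\rho(x)$. Suppose $\lambda>1$. (1) Let $(\xi_{a(v)})_{v\ne\emptyset}$ be random variables such that, for every vertex $u$ of colour $i$, the vector $(\xi_{a(u1)},\dots,\xi_{a(ud)})$ has the law of $(\eta_{i1},\dots,\eta_{id})$, and such that these vectors are independent for different $u\in\mathbb V$. Let $\xi[v]$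 be the product of the $\xi_a$ over the edges $a$ of the path from $\emptyset$ to $v$, with $\xi[\emptyset]=1$. Then $Z_n=\sum_{k=0}^n\sum_{v\in\mathbb V_k}\xi[v]\to\infty$ almost surely. (2) Let $(p_{v,0},p_{v,1},\dots,p_{v,d})$, $v\neq\emptyset$, be independent random probability vectors with $p_{v,0}>0$ almost surely, such that, for every $v\ne\emptyset$ of colour $i$, the vector $(p_{v,j}/p_{v,0})_{1\le j\le d}$ has the law of $(\eta_{i1},\dots,\eta_{id})$, and let $(p_{\emptyset,1},\dots,p_{\emptyset,d})$ be a random probability vector. Consider, given these, the random walk on $\mathbb V$ that steps from $v$ to its child $vj$ with probability $p_{v,j}$ and, if $v\ne\emptyset$, to its parent with probability $p_{v,0}$. Put $\xi_{a(uj)}=p_{u,j}/p_{u,0}$ for $u\ne\emptyset$ and $\xi_{a(j)}=p_{\emptyset,j}$, with $\xi[v]$ and $Z_n$ as in (1). Then, almost surely: $Z_n\to\infty$; for every $c>0$ the measure $\pi[\emptyset]=c$, $\pi[v]=c\,\xi[v]/p_{v,0}$ $(v\neq\emptyset)$ is invariant for the walk and has infinite total mass, hence cannot be normalised; and the walk is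 not ergodic, i.e. it admits no stationary probability distribution. -/

import Mathlib

open MeasureTheory ProbabilityTheory Filter

/-- Vertices of the rooted `d`-ary tree. The word `(v₁, …, vₙ)` is stored with its last letter
first, as the list `[vₙ, …, v₁]`. So `[]` is the root, the children of `u` are the `j :: u`, and
the edge from `u` to `j :: u` is indexed by its most remote vertex `j :: u`. -/
abbrev TreeVertex (d : ℕ) : Type := List (Fin d)

/-- The colour of a vertex: its last letter, and `α` at the root. -/
def vertexColour {d : ℕ} (α : Fin d) : TreeVertex d → Fin d
  | [] => α
  | j :: _ => j

/-- `ξ[v]`: the product of the edge values along the path from the root to `v`.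
The value of `ξ` at the root (which indexes no edge) is never used. -/
def pathWeight {d : ℕ} (ξ : TreeVertex d → ℝ) : TreeVertex d → ℝ
  | [] => 1
  | j :: u => pathWeight ξ u * ξ (j :: u)

/-- `Yₙ = ∑_{|v| = n} ξ[v]`, the multiplicative chaos. -/
def chaosY {d : ℕ} (ξ : TreeVertex d → ℝ) (n : ℕ) : ℝ :=
  ∑ v : List.Vector (Fin d) n, pathWeight ξ v.toList

/-- `Zₙ = Y₀ + ⋯ + Yₙ`. -/
def chaosZ {d : ℕ} (ξ : TreeVertex d → ℝ) (n : ℕ) : ℝ :=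
  ∑ k ∈ Finset.range (n + 1), chaosY ξ k

/-- The matrix `m(x)` of moments `𝔼(ηᵢⱼ ^ x)`. -/
noncomputable def momentMatrix {d : ℕ} {Ω₀ : Type*} [MeasurableSpace Ω₀] (ν : Measure Ω₀)
    (η : Ω₀ → Matrix (Fin d) (Fin d) ℝ) (x : ℝ) : Matrix (Fin d) (Fin d) ℝ :=
  Matrix.of fun i j => ∫ ω, (η ω i j) ^ x ∂ν

/-- The largest real eigenvalue of a real square matrix. -/
noncomputable def largestEigenvalue {d : ℕ} (A : Matrix (Fin d) (Fin d) ℝ) : ℝ :=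
  sSup {μ : ℝ | Module.End.HasEigenvalue (Matrix.toLin' A) μ}

/-- `λ = inf_{x ∈ [0,1]} ρ(x)`, where `ρ(x)` is the largest eigenvalue of `m(x)`. -/
noncomputable def chaosLambda {d : ℕ} {Ω₀ : Type*} [MeasurableSpace Ω₀] (ν : Measure Ω₀)
    (η : Ω₀ → Matrix (Fin d) (Fin d) ℝ) : ℝ :=
  ⨅ x : Set.Icc (0 : ℝ) 1, largestEigenvalue (momentMatrix ν η (x : ℝ))

/-- `ξ` is a random edge environment on the coloured tree with root colour `α`: the edges from a
vertex `u` of colour `i` to its children carry a copy of the `i`-th row of `η`, and the families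
attached to different parents are independent. -/
structure IsColouredEdgeEnvironment {d : ℕ} {Ω Ω₀ : Type*} [MeasurableSpace Ω]
    [MeasurableSpace Ω₀] (P : Measure Ω) (ν : Measure Ω₀)
    (η : Ω₀ → Matrix (Fin d) (Fin d) ℝ) (α : Fin d) (ξ : Ω → TreeVertex d → ℝ) : Prop where
  row_law : ∀ u : TreeVertex d,
    IdentDistrib (fun ω (j : Fin d) => ξ ω (j :: u))
      (fun ω (j : Fin d) => η ω (vertexColour α u) j) P ν
  indep : iIndepFun (fun (u : TreeVertex d) (ω : Ω) (j : Fin d) => ξ ω (j :: u)) P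

/-- `p` is a random transition environment on the coloured tree. Here `p ω v 0` is the probability
of a step from `v` to its parent (meaningless, and never used, at the root) and `p ω v j.succ` the
probability of a step from `v` to its child `j :: v`. The vectors at the vertices other than the
root are independent, and for a vertex of colour `i` the vector of ratios of outward over inward
probabilities has the law of the `i`-th row of `η`. -/
structure IsColouredWalkEnvironment {d : ℕ} {Ω Ω₀ : Type*} [MeasurableSpace Ω]
    [MeasurableSpace Ω₀] (P : Measure Ω) (ν : Measure Ω₀)
    (η : Ω₀ → Matrix (Fin d) (Fin d) ℝ) (α : Fin d)
    (p : Ω → TreeVertex d → Fin (d + 1) → ℝ) : Prop where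
  aemeasurable : ∀ v : TreeVertex d, AEMeasurable (fun ω => p ω v) P
  inward_pos : ∀ᵐ ω ∂P, ∀ v : TreeVertex d, v ≠ [] → 0 < p ω v 0
  outward_nonneg : ∀ᵐ ω ∂P, ∀ (v : TreeVertex d) (j : Fin d), 0 ≤ p ω v j.succ
  sum_eq_one : ∀ᵐ ω ∂P, ∀ v : TreeVertex d, v ≠ [] → ∑ j, p ω v j = 1
  root_sum_eq_one : ∀ᵐ ω ∂P, ∑ j : Fin d, p ω [] j.succ = 1
  ratio_law : ∀ v : TreeVertex d, v ≠ [] →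
    IdentDistrib (fun ω (j : Fin d) => p ω v j.succ / p ω v 0)
      (fun ω (j : Fin d) => η ω (vertexColour α v) j) P ν
  indep : iIndepFun (fun (v : {v : TreeVertex d // v ≠ []}) (ω : Ω) => p ω v.1) P

/-- The edge environment of a transition environment: outward over inward probability at the
parent `u` of the edge, and just the outward probability if `u` is the root. -/
noncomputable def edgeRatio {d : ℕ} (p : TreeVertex d → Fin (d + 1) → ℝ) : TreeVertex d → ℝ
  | [] => 1
  | [j] => p [] j.succ
  | j :: i :: u => p (i :: u) j.succ / p (i :: u) 0

/-- The transition matrix of the nearest neighbour random walk on the tree. -/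
def treeTransition {d : ℕ} (p : TreeVertex d → Fin (d + 1) → ℝ) (u v : TreeVertex d) : ℝ :=
  (∑ j : Fin d, if v = j :: u then p u j.succ else 0) +
    ∑ i : Fin d, if u = i :: v then p u 0 else 0

/-- `π` is a (nonnegative) invariant measure of the walk. -/
def IsInvariantMeasure {d : ℕ} (p : TreeVertex d → Fin (d + 1) → ℝ) (π : TreeVertex d → ℝ) :
    Prop :=
  (∀ v, 0 ≤ π v) ∧ ∀ v', HasSum (fun v => π v * treeTransition p v v') (π v')

/-- The measure `π[v] = c ξ[v] / p_{v,0}` for `v` other than the root, `π[∅] = c`. -/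
noncomputable def chaosMeasure {d : ℕ} (p : TreeVertex d → Fin (d + 1) → ℝ) (c : ℝ) :
    TreeVertex d → ℝ
  | [] => c
  | j :: u => c * pathWeight (edgeRatio p) (j :: u) * (1 / p (j :: u) 0)

/-- The walk is ergodic (positive recurrent): it admits a stationary probability distribution. -/
def IsErgodicWalk {d : ℕ} (p : TreeVertex d → Fin (d + 1) → ℝ) : Prop :=
  ∃ π : TreeVertex d → ℝ, IsInvariantMeasure p π ∧ HasSum π 1

open scoped ENNReal

/-! ### Subinvariant vectors of nonnegative matrices -/

lemma matrix_pow_apply_nonneg {d : ℕ} {m : Matrix (Fin d) (Fin d) ℝ}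
    (h0 : ∀ i j, 0 ≤ m i j) (n : ℕ) : ∀ i j, 0 ≤ (m ^ n) i j := by
  induction n with
  | zero => intro i j; rw [pow_zero, Matrix.one_apply]; split_ifs <;> norm_num
  | succ n ih =>
    intro i j
    rw [pow_succ, Matrix.mul_apply]
    exact Finset.sum_nonneg fun k _ => mul_nonneg (ih i k) (h0 k j)

lemma exists_hasEigenvalue_of_one_lt_largestEigenvalue {d : ℕ} {m : Matrix (Fin d) (Fin d) ℝ}
    (hl : 1 < largestEigenvalue m) :
    ∃ μ : ℝ, 1 < μ ∧ Module.End.HasEigenvalue (Matrix.toLin' m) μ := by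
  unfold largestEigenvalue at hl
  have hne : {μ : ℝ | Module.End.HasEigenvalue (Matrix.toLin' m) μ}.Nonempty := by
    by_contra h
    rw [Set.not_nonempty_iff_eq_empty] at h
    rw [h, Real.sSup_empty] at hl
    linarith
  obtain ⟨μ, h1, h2⟩ := exists_lt_of_lt_csSup hne hl
  exact ⟨μ, h2, h1⟩

/-- Singularity of `m - μ` is a determinant condition, so right and left eigenvalues agree. -/
lemma exists_vecMul_eq_smul_of_hasEigenvalue {d : ℕ} {m : Matrix (Fin d) (Fin d) ℝ} {μ : ℝ}
    (h : Module.End.HasEigenvalue (Matrix.toLin' m) μ) :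
    ∃ v : Fin d → ℝ, v ≠ 0 ∧ Matrix.vecMul v m = μ • v := by
  obtain ⟨w, hw⟩ := h.exists_hasEigenvector
  have h1 : m.mulVec w = μ • w := by simpa using hw.apply_eq_smul
  have h2 : (m - μ • (1 : Matrix (Fin d) (Fin d) ℝ)).det = 0 := by
    rw [← Matrix.exists_mulVec_eq_zero_iff]
    refine ⟨w, hw.2, ?_⟩
    rw [Matrix.sub_mulVec, h1, Matrix.smul_mulVec, Matrix.one_mulVec, sub_self]
  rw [← Matrix.exists_vecMul_eq_zero_iff] at h2
  obtain ⟨v, hv, h3⟩ := h2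
  refine ⟨v, hv, ?_⟩
  rw [Matrix.vecMul_sub, Matrix.vecMul_smul, Matrix.vecMul_one] at h3
  exact sub_eq_zero.1 h3

/-- A weak substitute for Perron–Frobenius. For a left eigenvector `v`, the triangle inequality
makes `|v|` a subeigenvector; multiplying by `m ^ N`, which commutes with `m`, makes it strictly
positive. -/
lemma exists_pos_vecMul_ge_of_largestEigenvalue {d : ℕ} {m : Matrix (Fin d) (Fin d) ℝ}
    (h0 : ∀ i j, 0 ≤ m i j) {N : ℕ} (hN : ∀ i j, 0 < (m ^ N) i j)
    (hl : 1 < largestEigenvalue m) :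
    ∃ l : Fin d → ℝ, (∀ i, 0 < l i) ∧ ∃ μ : ℝ, 1 < μ ∧ ∀ j, μ * l j ≤ ∑ i, l i * m i j := by
  obtain ⟨μ, hμ, he⟩ := exists_hasEigenvalue_of_one_lt_largestEigenvalue hl
  obtain ⟨v, hv, hvm⟩ := exists_vecMul_eq_smul_of_hasEigenvalue he
  have h1 : ∀ j, μ * |v j| ≤ ∑ i, |v i| * m i j := by
    intro j
    have : μ * v j = ∑ i, v i * m i j := by
      have := congrFun hvm j
      simp only [Matrix.vecMul, dotProduct, Pi.smul_apply, smul_eq_mul] at this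
      exact this.symm
    calc μ * |v j| = |μ * v j| := by rw [abs_mul, abs_of_pos (by linarith : 0 < μ)]
      _ = |∑ i, v i * m i j| := by rw [this]
      _ ≤ ∑ i, |v i * m i j| := Finset.abs_sum_le_sum_abs _ _
      _ = _ := Finset.sum_congr rfl fun i _ => by rw [abs_mul, abs_of_nonneg (h0 i j)]
  refine ⟨fun j => ∑ i, |v i| * (m ^ N) i j, ?_, μ, hμ, ?_⟩
  · intro j
    obtain ⟨i, hi⟩ := Function.ne_iff.1 hv
    refine Finset.sum_pos' (fun i _ => mul_nonneg (abs_nonneg _) (hN i j).le)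
      ⟨i, Finset.mem_univ _, mul_pos (abs_pos.2 hi) (hN i j)⟩
  · intro j
    calc μ * ∑ i, |v i| * (m ^ N) i j = ∑ i, (μ * |v i|) * (m ^ N) i j := by
          rw [Finset.mul_sum]; exact Finset.sum_congr rfl fun i _ => by ring
      _ ≤ ∑ i, (∑ k, |v k| * m k i) * (m ^ N) i j :=
          Finset.sum_le_sum fun i _ => mul_le_mul_of_nonneg_right (h1 i) (hN i j).le
      _ = ∑ k, |v k| * (m * m ^ N) k j := by
          simp_rw [Finset.sum_mul, Matrix.mul_apply, Finset.mul_sum]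
          rw [Finset.sum_comm]
          exact Finset.sum_congr rfl fun i _ => Finset.sum_congr rfl fun k _ => by ring
      _ = ∑ k, |v k| * (m ^ N * m) k j := by rw [← pow_succ', pow_succ]
      _ = _ := by
          simp_rw [Finset.sum_mul, Matrix.mul_apply, Finset.mul_sum]
          rw [Finset.sum_comm]
          exact Finset.sum_congr rfl fun i _ => Finset.sum_congr rfl fun k _ => by ring

/-- Serves the exponent `x = 0`. Column sums of `A ^ N` are at least `d ≥ 2`, so with `θ ^ N = 2`
the vector `l = ∑_{k < N} θ^{-k} 1ᵀ A^k` telescopes: `l A = θ (l + s_N - s_0)`, where `s_N ≥ 1 =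
s_0`. -/
lemma exists_pos_vecMul_ge_of_one_le_pow {d : ℕ} (hd : 2 ≤ d) {A : Matrix (Fin d) (Fin d) ℝ}
    (h0 : ∀ i j, 0 ≤ A i j) {N : ℕ} (hN : ∀ i j, 1 ≤ (A ^ N) i j) :
    ∃ l : Fin d → ℝ, (∀ i, 0 < l i) ∧ ∃ μ : ℝ, 1 < μ ∧ ∀ j, μ * l j ≤ ∑ i, l i * A i j := by
  have hN0 : N ≠ 0 := by
    rintro rfl
    have := hN ⟨0, by omega⟩ ⟨1, by omega⟩
    rw [pow_zero, Matrix.one_apply_ne (by simp)] at this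
    linarith
  set θ : ℝ := (2 : ℝ) ^ ((N : ℝ)⁻¹) with hθ
  have hθN : θ ^ N = 2 := Real.rpow_inv_natCast_pow (by norm_num) hN0
  have hθ1 : 1 < θ := Real.one_lt_rpow (by norm_num) (by positivity)
  have hθ0 : 0 < θ := by linarith
  set a : ℕ → Fin d → ℝ := fun k j => ∑ i, (A ^ k) i j with ha
  have ha0 : ∀ k j, 0 ≤ a k j := fun k j =>
    Finset.sum_nonneg fun i _ => matrix_pow_apply_nonneg h0 k i j
  have ha1 : ∀ j, a 0 j = 1 := by intro j; simp [ha, Matrix.one_apply]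
  have haN : ∀ j, 2 ≤ a N j := by
    intro j
    calc (2 : ℝ) ≤ d := by exact_mod_cast hd
      _ = ∑ i : Fin d, (1 : ℝ) := by simp
      _ ≤ _ := Finset.sum_le_sum fun i _ => hN i j
  have hsucc : ∀ k j, ∑ i, a k i * A i j = a (k + 1) j := by
    intro k j
    simp only [ha, pow_succ, Matrix.mul_apply, Finset.sum_mul]
    exact Finset.sum_comm
  set s : ℕ → Fin d → ℝ := fun k j => (θ ^ k)⁻¹ * a k j with hs
  have hs0 : ∀ k j, 0 ≤ s k j := fun k j => mul_nonneg (by positivity) (ha0 k j)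
  refine ⟨fun j => ∑ k ∈ Finset.range N, s k j, ?_, θ, hθ1, ?_⟩
  · intro j
    refine Finset.sum_pos' (fun k _ => hs0 k j) ⟨0, by simp; omega, ?_⟩
    simp [hs, ha1]
  · intro j
    have h1 : ∑ i, (∑ k ∈ Finset.range N, s k i) * A i j
        = θ * ∑ k ∈ Finset.range N, s (k + 1) j := by
      simp_rw [Finset.sum_mul]
      rw [Finset.sum_comm, Finset.mul_sum]
      refine Finset.sum_congr rfl fun k _ => ?_
      simp only [hs, ← hsucc, mul_assoc, ← Finset.mul_sum]
      rw [← mul_assoc, pow_succ]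
      congr 1
      field_simp
    rw [h1]
    refine mul_le_mul_of_nonneg_left ?_ hθ0.le
    have h2 := Finset.sum_range_succ (fun k => s k j) N
    have h3 := Finset.sum_range_succ' (fun k => s k j) N
    have h4 : s 0 j = 1 := by simp [hs, ha1]
    have h5 : 1 ≤ s N j := by
      simp only [hs, hθN]
      have := haN j
      linarith
    linarith

/-! ### Supersolutions of convolution inequalities on a half-line -/

/-- For `s` strictly between `max 1 q` and `r`, once `b n ≥ C / (r - s)` the constant is absorbed
and `s * b n ≤ b (n + 1)`; growth at rate `s` then beats the bound at rate `q`. -/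
lemma false_of_geometric_growth_of_lower_rate {b : ℕ → ℝ} {r q C D : ℝ} (hr : 1 < r) (hq : 0 < q)
    (hqr : q < r) (hb : Tendsto b atTop atTop) (hrec : ∀ n, r * b n ≤ b (n + 1) + C)
    (hbd : ∀ n, b n ≤ D * q ^ n) : False := by
  obtain ⟨s, hs1, hs2⟩ := exists_between (max_lt hr hqr)
  have h1s : 1 < s := (le_max_left _ _).trans_lt hs1
  have hqs : q < s := (le_max_right _ _).trans_lt hs1
  have hev : ∀ᶠ n in atTop, max 1 (C / (r - s)) ≤ b n := hb.eventually_ge_atTop _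
  obtain ⟨n0, hn0⟩ := eventually_atTop.1 hev
  have hstep : ∀ n, n0 ≤ n → s * b n ≤ b (n + 1) := by
    intro n hn
    have h1 := (le_max_right _ _).trans (hn0 n hn)
    rw [div_le_iff₀ (by linarith)] at h1
    have := hrec n
    nlinarith
  have hpow : ∀ m, s ^ m * b n0 ≤ b (n0 + m) := by
    intro m
    induction m with
    | zero => simp
    | succ m ih =>
      calc s ^ (m + 1) * b n0 = s * (s ^ m * b n0) := by ring
        _ ≤ s * b (n0 + m) := mul_le_mul_of_nonneg_left ih (by linarith)
        _ ≤ _ := hstep _ (by omega)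
  have hb0 : 0 < b n0 := lt_of_lt_of_le one_pos ((le_max_left _ _).trans (hn0 n0 le_rfl))
  have hlim : Tendsto (fun m : ℕ => D * q ^ n0 * (q / s) ^ m) atTop (nhds 0) := by
    have := (tendsto_pow_atTop_nhds_zero_of_lt_one (by positivity : 0 ≤ q / s)
      ((div_lt_one (by linarith)).2 hqs)).const_mul (D * q ^ n0)
    simpa using this
  obtain ⟨m, hm⟩ := (hlim.eventually_lt_const hb0).exists
  have h1 := (hpow m).trans (hbd (n0 + m))
  have hsm : 0 < s ^ m := by positivity
  rw [div_pow, ← mul_div_assoc, div_lt_iff₀ hsm] at hm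
  rw [pow_add] at h1
  nlinarith


/-- `∫_A g(u) e^{-xu} du`. -/
noncomputable def expIntegral (g : ℝ → ℝ≥0∞) (x : ℝ) (A : Set ℝ) : ℝ≥0∞ :=
  ∫⁻ u in A, g u * ENNReal.ofReal (Real.exp (-(x * u)))

lemma expIntegral_mono (g : ℝ → ℝ≥0∞) (x : ℝ) {A B : Set ℝ} (h : A ⊆ B) :
    expIntegral g x A ≤ expIntegral g x B :=
  lintegral_mono_set h

lemma expIntegral_translate {g : ℝ → ℝ≥0∞} (x h a b : ℝ) :
    ∫⁻ u in Set.Ioc a b, g (u + h) * ENNReal.ofReal (Real.exp (-(x * u)))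
      = ENNReal.ofReal (Real.exp (x * h)) * expIntegral g x (Set.Ioc (a + h) (b + h)) := by
  unfold expIntegral
  rw [← lintegral_indicator measurableSet_Ioc, ← lintegral_indicator measurableSet_Ioc,
    ← lintegral_const_mul' _ _ ENNReal.ofReal_ne_top]
  conv_rhs => rw [← lintegral_add_right_eq_self _ h]
  refine lintegral_congr fun u => ?_
  by_cases hu : u ∈ Set.Ioc a b
  · have hu' : u + h ∈ Set.Ioc (a + h) (b + h) := by
      simpa [Set.mem_Ioc] using hu
    rw [Set.indicator_of_mem hu, Set.indicator_of_mem hu', mul_left_comm,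
      ← ENNReal.ofReal_mul (Real.exp_pos _).le, ← Real.exp_add]
    congr 4
    ring
  · have hu' : u + h ∉ Set.Ioc (a + h) (b + h) := by
      simpa [Set.mem_Ioc] using hu
    rw [Set.indicator_of_notMem hu, Set.indicator_of_notMem hu', mul_zero]

/-- The exponential weight turns convolution into multiplication, by Tonelli and translation. A
shift by `h` with `|h| ≤ k` moves the window by at most `k`, which is why it shrinks by `k` at both
ends. -/
lemma sum_moment_mul_expIntegral_le {ι : Type*} [Fintype ι] {f : ℝ → ℝ≥0∞} {G : ι → ℝ → ℝ≥0∞}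
    (hG : ∀ j, Measurable (G j)) {W : ι → Measure ℝ} [∀ j, SFinite (W j)] {k u₀ : ℝ}
    (hW : ∀ j, ∀ᵐ h ∂W j, |h| ≤ k)
    (hsup : ∀ u ≤ u₀, ∑ j, ∫⁻ h, G j (u + h) ∂W j ≤ f u) (x a : ℝ) {b : ℝ} (hb : b ≤ u₀) :
    ∑ j, (∫⁻ h, ENNReal.ofReal (Real.exp (x * h)) ∂W j) *
      expIntegral (G j) x (Set.Ioc (a + k) (b - k)) ≤ expIntegral f x (Set.Ioc a b) := by
  have hmeas : ∀ j, Measurable (fun p : ℝ × ℝ => G j (p.1 + p.2) *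
      ENNReal.ofReal (Real.exp (-(x * p.1)))) := fun j =>
    ((hG j).comp (measurable_fst.add measurable_snd)).mul (by fun_prop)
  have h1 : ∑ j, ∫⁻ u in Set.Ioc a b, ∫⁻ h, G j (u + h) *
      ENNReal.ofReal (Real.exp (-(x * u))) ∂W j ≤ expIntegral f x (Set.Ioc a b) := by
    rw [← lintegral_finsetSum _ fun j _ => (hmeas j).lintegral_prod_right']
    refine setLIntegral_mono' measurableSet_Ioc fun u hu => ?_
    simp_rw [lintegral_mul_const' _ _ ENNReal.ofReal_ne_top, ← Finset.sum_mul]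
    exact mul_le_mul_left (hsup u (hu.2.trans hb)) _
  refine le_trans (Finset.sum_le_sum fun j _ => ?_) h1
  rw [lintegral_lintegral_swap (hmeas j).aemeasurable]
  rw [← lintegral_mul_const _ (by fun_prop)]
  refine lintegral_mono_ae ?_
  filter_upwards [hW j] with h hh
  rw [expIntegral_translate]
  refine mul_le_mul_right (expIntegral_mono _ _ (Set.Ioc_subset_Ioc ?_ ?_)) _
  · linarith [(abs_le.1 hh).2]
  · linarith [(abs_le.1 hh).1]

lemma expIntegral_Iic_lt_top {g : ℝ → ℝ≥0∞} (hg : ∀ u, g u ≤ 1) {x : ℝ} (hx : x < 0) :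
    expIntegral g x (Set.Iic 0) < ∞ := by
  have h1 := (integrableOn_exp_mul_Iic (neg_pos.2 hx) 0).lintegral_lt_top
  refine lt_of_le_of_lt (lintegral_mono fun u => ?_) h1
  calc g u * ENNReal.ofReal (Real.exp (-(x * u))) ≤ 1 * ENNReal.ofReal (Real.exp (-(x * u))) :=
        mul_le_mul_left (hg u) _
    _ = ENNReal.ofReal (Real.exp (-x * u)) := by rw [one_mul, neg_mul]

lemma expIntegral_Ioc_lt_top {g : ℝ → ℝ≥0∞} (hg : ∀ u, g u ≤ 1) (x a b : ℝ) :
    expIntegral g x (Set.Ioc a b) < ∞ := by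
  have h1 : IntegrableOn (fun u => Real.exp (-(x * u))) (Set.Ioc a b) :=
    (Continuous.integrableOn_Icc (by fun_prop)).mono_set Set.Ioc_subset_Icc_self
  refine lt_of_le_of_lt (lintegral_mono fun u => ?_) h1.lintegral_lt_top
  calc g u * ENNReal.ofReal (Real.exp (-(x * u))) ≤ 1 * ENNReal.ofReal (Real.exp (-(x * u))) :=
        mul_le_mul_left (hg u) _
    _ = _ := one_mul _

lemma expIntegral_Iic_eq_top {g : ℝ → ℝ≥0∞} (hg : ∀ u, g u ≤ 1) {x u₀ : ℝ} (hu₀ : u₀ ≤ 0)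
    (h : expIntegral g x (Set.Iic 0) = ∞) : expIntegral g x (Set.Iic u₀) = ∞ := by
  by_contra hne
  have h1 : expIntegral g x (Set.Iic 0) ≤
      expIntegral g x (Set.Iic u₀) + expIntegral g x (Set.Ioc u₀ 0) := by
    rw [← Set.Iic_union_Ioc_eq_Iic hu₀]
    exact lintegral_union_le _ _ _
  rw [h, top_le_iff, ENNReal.add_eq_top] at h1
  exact h1.elim hne (expIntegral_Ioc_lt_top hg _ _ _).ne

lemma tendsto_expIntegral_Ioc {g : ℝ → ℝ≥0∞} {x u₀ k : ℝ} (hk : 0 < k) :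
    Tendsto (fun n : ℕ => expIntegral g x (Set.Ioc (u₀ - n * k) u₀)) atTop
      (nhds (expIntegral g x (Set.Iic u₀))) := by
  have hmono : Monotone fun n : ℕ => Set.Ioc (u₀ - n * k) u₀ := by
    intro m n hmn
    refine Set.Ioc_subset_Ioc_left ?_
    have : (m : ℝ) ≤ n := by exact_mod_cast hmn
    nlinarith
  have hU : ⋃ n : ℕ, Set.Ioc (u₀ - n * k) u₀ = Set.Iic u₀ := by
    ext u
    simp only [Set.mem_iUnion, Set.mem_Ioc, Set.mem_Iic]
    refine ⟨fun ⟨_, h⟩ => h.2, fun h => ?_⟩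
    obtain ⟨n, hn⟩ := exists_nat_gt ((u₀ - u) / k)
    rw [div_lt_iff₀ hk] at hn
    exact ⟨n, by linarith, h⟩
  have h1 := tendsto_measure_iUnion_atTop
    (μ := volume.withDensity fun u => g u * ENNReal.ofReal (Real.exp (-(x * u)))) hmono
  rw [hU, withDensity_apply _ measurableSet_Iic] at h1
  refine h1.congr fun n => ?_
  simp only [Function.comp]
  rw [withDensity_apply _ measurableSet_Ioc]
  rfl

lemma expIntegral_Ioc_le_of_lt {g : ℝ → ℝ≥0∞} {x₀ x₁ a b : ℝ} (hx : x₀ ≤ x₁) (hb : b ≤ 0) :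
    expIntegral g x₁ (Set.Ioc a b) ≤
      ENNReal.ofReal (Real.exp (-((x₁ - x₀) * a))) * expIntegral g x₀ (Set.Iic 0) := by
  have h1 : expIntegral g x₁ (Set.Ioc a b) ≤
      ENNReal.ofReal (Real.exp (-((x₁ - x₀) * a))) * expIntegral g x₀ (Set.Ioc a b) := by
    unfold expIntegral
    rw [← lintegral_const_mul' _ _ ENNReal.ofReal_ne_top]
    refine setLIntegral_mono' measurableSet_Ioc fun u hu => ?_
    rw [mul_left_comm, ← ENNReal.ofReal_mul (Real.exp_pos _).le, ← Real.exp_add]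
    refine mul_le_mul_right (ENNReal.ofReal_le_ofReal (Real.exp_le_exp.2 ?_)) _
    nlinarith [hu.1]
  exact h1.trans (mul_le_mul_right (expIntegral_mono _ _
    (Set.Ioc_subset_Iic_self.trans (Set.Iic_subset_Iic.2 hb))) _)

/-- Compare two growth rates of the weighted integrals over `(u₀ - n k, u₀]` just above the critical
exponent `xs`: the supersolution property forces rate at least `r`, and convergence just below `xs`
allows rate at most `q < r`. No regularity in `x` of the data `k, u₀, W, l, c` is needed. -/
lemma false_of_convolution_supersolution {ι : Type*} [Fintype ι] {G : ι → ℝ → ℝ≥0∞}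
    (hGm : ∀ i, Measurable (G i)) (hG1 : ∀ i u, G i u ≤ 1)
    (hlow : ∃ i, expIntegral (G i) 1 (Set.Iic 0) = ∞)
    (hsup : ∀ x ∈ Set.Icc (0 : ℝ) 1, ∃ k > 0, ∃ u₀ ≤ 0, ∃ (W : ι → ι → Measure ℝ) (l : ι → ℝ≥0∞)
      (c : ℝ), 1 < c ∧ (∀ i j, SFinite (W i j)) ∧ (∀ i j, ∀ᵐ h ∂W i j, |h| ≤ k) ∧
      (∀ i, ∀ u ≤ u₀, ∑ j, ∫⁻ h, G j (u + h) ∂W i j ≤ G i u) ∧ (∀ j, l j ≠ 0 ∧ l j ≠ ∞) ∧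
      ∀ j, ENNReal.ofReal c * l j ≤
        ∑ i, l i * ∫⁻ h, ENNReal.ofReal (Real.exp (x * h)) ∂W i j) : False := by
  set S : Set ℝ := {x | ∑ i, expIntegral (G i) x (Set.Iic 0) = ∞} with hS
  have h1S : (1 : ℝ) ∈ S := by
    obtain ⟨i, hi⟩ := hlow
    exact ENNReal.sum_eq_top.2 ⟨i, Finset.mem_univ _, hi⟩
  have hSlow : ∀ x ∈ S, 0 ≤ x := by
    intro x hx
    by_contra hneg
    obtain ⟨i, -, hi⟩ := ENNReal.sum_eq_top.1 hx
    exact (expIntegral_Iic_lt_top (hG1 i) (not_le.1 hneg)).ne hi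
  have hbdd : BddBelow S := ⟨0, hSlow⟩
  set xs := sInf S with hxs
  have hxs0 : 0 ≤ xs := le_csInf ⟨1, h1S⟩ hSlow
  have hxs1 : xs ≤ 1 := csInf_le hbdd h1S
  obtain ⟨k, hk, u₀, hu₀, W, l, c, hc, hWf, hWk, hineq, hl, hlc⟩ := hsup xs ⟨hxs0, hxs1⟩
  have hlogc : 0 < Real.log c := Real.log_pos hc
  -- With this choice `r = c ^ (3/4)` and `q = c ^ (1/2)`.
  set κ := Real.log c / (4 * k) with hκ
  have hκ0 : 0 < κ := by positivity
  have hκk : κ * k = Real.log c / 4 := by rw [hκ]; field_simp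
  -- The infimum need not be attained, so the divergence is used at a point `x₁ ∈ [xs, xs + κ)`.
  obtain ⟨x₁, hx₁S, hx₁⟩ := exists_lt_of_csInf_lt ⟨1, h1S⟩ (show sInf S < xs + κ by linarith)
  have hx₁' : xs ≤ x₁ := csInf_le hbdd hx₁S
  have hx₀ : xs - κ ∉ S := notMem_of_lt_csInf (by linarith) hbdd
  set r : ℝ := c * Real.exp (-(κ * k)) with hr
  set q : ℝ := Real.exp (2 * (κ * k)) with hq
  have hr0 : 0 < r := by positivity
  have hqr : q < r := by
    rw [hr, hq, ← Real.exp_log (by linarith : 0 < c), ← Real.exp_add, Real.exp_lt_exp,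
      hκk]
    linarith
  have hq1 : 1 ≤ q := Real.one_le_exp (by positivity)
  set B : ℝ → ℝ → ℝ≥0∞ := fun a b => ∑ j, l j * expIntegral (G j) x₁ (Set.Ioc a b) with hB
  have hBfin : ∀ a b, B a b ≠ ∞ := fun a b => ENNReal.sum_ne_top.2 fun j _ =>
    ENNReal.mul_ne_top (hl j).2 (expIntegral_Ioc_lt_top (hG1 j) _ _ _).ne
  -- the weighted moments at `x₁`
  have hmom : ∀ j, ENNReal.ofReal r * l j ≤
      ∑ i, l i * ∫⁻ h, ENNReal.ofReal (Real.exp (x₁ * h)) ∂W i j := by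
    intro j
    calc ENNReal.ofReal r * l j
        = ENNReal.ofReal (Real.exp (-(κ * k))) * (ENNReal.ofReal c * l j) := by
          rw [hr, mul_comm c, ENNReal.ofReal_mul (Real.exp_pos _).le, mul_assoc]
      _ ≤ ENNReal.ofReal (Real.exp (-(κ * k))) *
          ∑ i, l i * ∫⁻ h, ENNReal.ofReal (Real.exp (xs * h)) ∂W i j :=
          mul_le_mul_right (hlc j) _
      _ = ∑ i, l i * ∫⁻ h, ENNReal.ofReal (Real.exp (-(κ * k))) *
          ENNReal.ofReal (Real.exp (xs * h)) ∂W i j := by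
          rw [Finset.mul_sum]
          refine Finset.sum_congr rfl fun i _ => ?_
          rw [lintegral_const_mul' _ _ ENNReal.ofReal_ne_top, mul_left_comm]
      _ ≤ _ := by
          refine Finset.sum_le_sum fun i _ => mul_le_mul_right (lintegral_mono_ae ?_) _
          filter_upwards [hWk i j] with h hh
          rw [← ENNReal.ofReal_mul (Real.exp_pos _).le, ← Real.exp_add]
          refine ENNReal.ofReal_le_ofReal (Real.exp_le_exp.2 ?_)
          obtain ⟨h1, h2⟩ := abs_le.1 hh
          have h3 : 0 ≤ (x₁ - xs) * (h + k) := mul_nonneg (by linarith) (by linarith)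
          have h4 : 0 ≤ (xs + κ - x₁) * k := mul_nonneg (by linarith) hk.le
          nlinarith
  have hBstep : ∀ a, ENNReal.ofReal r * B (a + k) (u₀ - k) ≤ B a u₀ := by
    intro a
    calc ENNReal.ofReal r * B (a + k) (u₀ - k)
        = ∑ j, (ENNReal.ofReal r * l j) *
            expIntegral (G j) x₁ (Set.Ioc (a + k) (u₀ - k)) := by
          rw [hB, Finset.mul_sum]
          exact Finset.sum_congr rfl fun j _ => (mul_assoc _ _ _).symm
      _ ≤ ∑ j, (∑ i, l i * ∫⁻ h, ENNReal.ofReal (Real.exp (x₁ * h)) ∂W i j) *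
            expIntegral (G j) x₁ (Set.Ioc (a + k) (u₀ - k)) :=
          Finset.sum_le_sum fun j _ => mul_le_mul_left (hmom j) _
      _ = ∑ i, l i * ∑ j, (∫⁻ h, ENNReal.ofReal (Real.exp (x₁ * h)) ∂W i j) *
            expIntegral (G j) x₁ (Set.Ioc (a + k) (u₀ - k)) := by
          simp_rw [Finset.sum_mul, Finset.mul_sum, mul_assoc]
          exact Finset.sum_comm
      _ ≤ _ := by
          refine Finset.sum_le_sum fun i _ => mul_le_mul_right ?_ _
          have := hWf i
          exact sum_moment_mul_expIntegral_le hGm (hWk i) (hineq i) x₁ a le_rfl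
  have hBsplit : ∀ a, B a u₀ ≤ B a (u₀ - k) + B (u₀ - k) u₀ := by
    intro a
    rw [hB, ← Finset.sum_add_distrib]
    refine Finset.sum_le_sum fun j _ => ?_
    rw [← mul_add]
    refine mul_le_mul_right (le_trans (expIntegral_mono _ _ ?_) (lintegral_union_le _ _ _)) _
    exact Set.Ioc_subset_Ioc_union_Ioc
  set b : ℕ → ℝ := fun n => (B (u₀ - n * k) u₀).toReal with hb
  refine false_of_geometric_growth_of_lower_rate (b := b) (r := r) (q := q)
    (C := r * (B (u₀ - k) u₀).toReal)
    (D := (∑ j, l j * (ENNReal.ofReal (Real.exp (-((x₁ - (xs - κ)) * u₀))) *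
      expIntegral (G j) (xs - κ) (Set.Iic 0))).toReal)
    (hq1.trans_lt hqr) (by positivity) hqr ?_ ?_ ?_
  · have h1 : Tendsto (fun n : ℕ => B (u₀ - n * k) u₀) atTop (nhds ∞) := by
      have h2 : Tendsto (fun n : ℕ => B (u₀ - n * k) u₀) atTop
          (nhds (∑ j, l j * expIntegral (G j) x₁ (Set.Iic u₀))) :=
        tendsto_finsetSum _ fun j _ => ENNReal.Tendsto.const_mul (tendsto_expIntegral_Ioc hk)
          (Or.inr (hl j).2)
      have h3 : ∑ j, l j * expIntegral (G j) x₁ (Set.Iic u₀) = ∞ := by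
        obtain ⟨i, -, hi⟩ := ENNReal.sum_eq_top.1 hx₁S
        refine ENNReal.sum_eq_top.2 ⟨i, Finset.mem_univ _, ?_⟩
        rw [expIntegral_Iic_eq_top (hG1 i) hu₀ hi, ENNReal.mul_top (hl i).1]
      rwa [h3] at h2
    refine tendsto_atTop.2 fun M => ?_
    filter_upwards [h1.eventually (lt_mem_nhds (ENNReal.ofReal_lt_top (r := M)))] with n hn
    exact (ENNReal.ofReal_le_iff_le_toReal (hBfin _ _)).1 hn.le
  -- Moving the lower end down by `k` gains the factor `r`; the strip `(u₀ - k, u₀]` lost at the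
  -- upper end contributes the constant `C`.
  · intro n
    have h1 : ENNReal.ofReal r * B (u₀ - n * k) u₀ ≤
        B (u₀ - (n + 1 : ℕ) * k) u₀ + ENNReal.ofReal r * B (u₀ - k) u₀ := by
      calc ENNReal.ofReal r * B (u₀ - n * k) u₀
          ≤ ENNReal.ofReal r * (B (u₀ - n * k) (u₀ - k) + B (u₀ - k) u₀) :=
            mul_le_mul_right (hBsplit _) _
        _ ≤ _ := by
            rw [mul_add]
            refine add_le_add_left ?_ _
            have h2 := hBstep (u₀ - (n + 1 : ℕ) * k)
            have h3 : u₀ - (n + 1 : ℕ) * k + k = u₀ - n * k := by push_cast; ring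
            rwa [h3] at h2
    have h2 := ENNReal.toReal_mono
      (ENNReal.add_ne_top.2 ⟨hBfin _ _, ENNReal.mul_ne_top ENNReal.ofReal_ne_top (hBfin _ _)⟩) h1
    rw [ENNReal.toReal_add (hBfin _ _) (ENNReal.mul_ne_top ENNReal.ofReal_ne_top (hBfin _ _)),
      ENNReal.toReal_mul, ENNReal.toReal_mul, ENNReal.toReal_ofReal hr0.le] at h2
    exact h2
  -- The rate `q` comes from `x₁ - (xs - κ) ≤ 2κ` and a window of length `n k`; the integral at `xs
  -- - κ`, below the infimum of `S`, is finite.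
  · intro n
    have hfin : (∑ j, l j * (ENNReal.ofReal (Real.exp (-((x₁ - (xs - κ)) * u₀))) *
        expIntegral (G j) (xs - κ) (Set.Iic 0))) ≠ ∞ := by
      refine ENNReal.sum_ne_top.2 fun j _ => ENNReal.mul_ne_top (hl j).2
        (ENNReal.mul_ne_top ENNReal.ofReal_ne_top fun htop => hx₀ ?_)
      exact ENNReal.sum_eq_top.2 ⟨j, Finset.mem_univ _, htop⟩
    have h1 : B (u₀ - n * k) u₀ ≤ ENNReal.ofReal (q ^ n) *
        ∑ j, l j * (ENNReal.ofReal (Real.exp (-((x₁ - (xs - κ)) * u₀))) *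
          expIntegral (G j) (xs - κ) (Set.Iic 0)) := by
      rw [hB, Finset.mul_sum]
      refine Finset.sum_le_sum fun j _ => ?_
      rw [mul_left_comm, ← mul_assoc (ENNReal.ofReal (q ^ n)),
        ← ENNReal.ofReal_mul (by positivity), hq, ← Real.exp_nat_mul, ← Real.exp_add]
      refine mul_le_mul_right (le_trans (expIntegral_Ioc_le_of_lt
        (by linarith : xs - κ ≤ x₁) hu₀) (mul_le_mul_left ?_ _)) _
      refine ENNReal.ofReal_le_ofReal (Real.exp_le_exp.2 ?_)
      have hn : (0 : ℝ) ≤ n := n.cast_nonneg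
      have h3 : 0 ≤ (xs + κ - x₁) * (n * k) := mul_nonneg (by linarith) (by positivity)
      nlinarith
    have h2 := ENNReal.toReal_mono (ENNReal.mul_ne_top ENNReal.ofReal_ne_top hfin) h1
    rw [ENNReal.toReal_mul, ENNReal.toReal_ofReal (by positivity)] at h2
    exact h2.trans_eq (mul_comm _ _)

/-! ### Laplace transforms of the partial sums -/

/-- The Laplace transform of `Zₙ` for the environment with root colour `i`, by recursion on `n`;
negative arguments are replaced by `0`. -/
noncomputable def chaosLaplace {d : ℕ} {Ω₀ : Type*} [MeasurableSpace Ω₀] (ν : Measure Ω₀)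
    (η : Ω₀ → Matrix (Fin d) (Fin d) ℝ) : ℕ → Fin d → ℝ → ℝ
  | 0, _, t => Real.exp (-max t 0)
  | n + 1, i, t => Real.exp (-max t 0) * ∫ ω, ∏ j, chaosLaplace ν η n j (max t 0 * η ω i j) ∂ν

/-- The Laplace transform of `lim Zₙ`. -/
noncomputable def chaosLaplaceLimit {d : ℕ} {Ω₀ : Type*} [MeasurableSpace Ω₀] (ν : Measure Ω₀)
    (η : Ω₀ → Matrix (Fin d) (Fin d) ℝ) (i : Fin d) (t : ℝ) : ℝ :=
  ⨅ n, chaosLaplace ν η n i t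

section

variable {d : ℕ} {Ω₀ : Type*} [MeasurableSpace Ω₀] {ν : Measure Ω₀} [IsProbabilityMeasure ν]
  {η : Ω₀ → Matrix (Fin d) (Fin d) ℝ}

lemma exp_neg_max_le_one (t : ℝ) : Real.exp (-max t 0) ≤ 1 :=
  Real.exp_le_one_iff.2 (neg_nonpos.2 (le_max_right _ _))

lemma integrable_prod_comp_mul (hm : ∀ i j, AEMeasurable (fun ω => η ω i j) ν)
    {f : Fin d → ℝ → ℝ} (hf : ∀ j, Antitone (f j)) (hf0 : ∀ j t, 0 ≤ f j t)
    (hf1 : ∀ j t, f j t ≤ 1) (i : Fin d) (t : ℝ) :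
    Integrable (fun ω => ∏ j, f j (t * η ω i j)) ν := by
  have h1 : AEMeasurable (fun ω => ∏ j, f j (t * η ω i j)) ν :=
    Finset.aemeasurable_fun_prod _ fun j _ =>
      (hf j).measurable.comp_aemeasurable ((hm i j).const_mul t)
  refine Integrable.of_bound h1.aestronglyMeasurable 1 (ae_of_all _ fun ω => ?_)
  rw [Real.norm_eq_abs, abs_of_nonneg (Finset.prod_nonneg fun j _ => hf0 j _)]
  exact Finset.prod_le_one (fun j _ => hf0 j _) fun j _ => hf1 j _

lemma integral_prod_comp_mul_le_one (hm : ∀ i j, AEMeasurable (fun ω => η ω i j) ν)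
    {f : Fin d → ℝ → ℝ} (hf : ∀ j, Antitone (f j)) (hf0 : ∀ j t, 0 ≤ f j t)
    (hf1 : ∀ j t, f j t ≤ 1) (i : Fin d) (t : ℝ) :
    ∫ ω, ∏ j, f j (t * η ω i j) ∂ν ≤ 1 := by
  have h := integral_mono (integrable_prod_comp_mul hm hf hf0 hf1 i t) (integrable_const (1 : ℝ))
    fun ω => Finset.prod_le_one (fun j _ => hf0 j _) fun j _ => hf1 j _
  simpa using h

/-- The three properties go through one induction: monotonicity supplies the measurability, and the
bounds the integrability, of the product in the recursion. Truncating negative arguments keeps them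
valid on all of `ℝ`. -/
lemma chaosLaplace_basic (hm : ∀ i j, AEMeasurable (fun ω => η ω i j) ν)
    (h0 : ∀ i j, ∀ᵐ ω ∂ν, 0 ≤ η ω i j) (n : ℕ) :
    ∀ i, (∀ t, 0 ≤ chaosLaplace ν η n i t) ∧
      (∀ t, chaosLaplace ν η n i t ≤ Real.exp (-max t 0)) ∧ Antitone (chaosLaplace ν η n i) := by
  induction n with
  | zero =>
    intro i
    refine ⟨fun t => (Real.exp_pos _).le, fun t => le_rfl, fun s t hst => ?_⟩
    exact Real.exp_le_exp.2 (neg_le_neg (max_le_max_right 0 hst))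
  | succ n ih =>
    intro i
    have hf : ∀ j, Antitone (chaosLaplace ν η n j) := fun j => (ih j).2.2
    have hf0 : ∀ j t, 0 ≤ chaosLaplace ν η n j t := fun j => (ih j).1
    have hf1 : ∀ j t, chaosLaplace ν η n j t ≤ 1 := fun j t =>
      ((ih j).2.1 t).trans (exp_neg_max_le_one t)
    have hI0 : ∀ t, 0 ≤ ∫ ω, ∏ j, chaosLaplace ν η n j (max t 0 * η ω i j) ∂ν := fun t =>
      integral_nonneg fun ω => Finset.prod_nonneg fun j _ => hf0 j _
    refine ⟨fun t => mul_nonneg (Real.exp_pos _).le (hI0 t), fun t => ?_, fun s t hst => ?_⟩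
    · exact mul_le_of_le_one_right (Real.exp_pos _).le
        (integral_prod_comp_mul_le_one hm hf hf0 hf1 i _)
    · refine mul_le_mul (Real.exp_le_exp.2 (neg_le_neg (max_le_max_right 0 hst))) ?_ (hI0 t)
        (Real.exp_pos _).le
      refine integral_mono_ae (integrable_prod_comp_mul hm hf hf0 hf1 i _)
        (integrable_prod_comp_mul hm hf hf0 hf1 i _) ?_
      filter_upwards [ae_all_iff.2 fun j => h0 i j] with ω hω
      exact Finset.prod_le_prod (fun j _ => hf0 j _) fun j _ =>
        hf j (mul_le_mul_of_nonneg_right (max_le_max_right 0 hst) (hω j))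

lemma chaosLaplace_nonneg (hm : ∀ i j, AEMeasurable (fun ω => η ω i j) ν)
    (h0 : ∀ i j, ∀ᵐ ω ∂ν, 0 ≤ η ω i j) (n : ℕ) (i : Fin d) (t : ℝ) :
    0 ≤ chaosLaplace ν η n i t :=
  (chaosLaplace_basic hm h0 n i).1 t

lemma chaosLaplace_le_exp (hm : ∀ i j, AEMeasurable (fun ω => η ω i j) ν)
    (h0 : ∀ i j, ∀ᵐ ω ∂ν, 0 ≤ η ω i j) (n : ℕ) (i : Fin d) (t : ℝ) :
    chaosLaplace ν η n i t ≤ Real.exp (-max t 0) :=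
  (chaosLaplace_basic hm h0 n i).2.1 t

lemma chaosLaplace_le_one (hm : ∀ i j, AEMeasurable (fun ω => η ω i j) ν)
    (h0 : ∀ i j, ∀ᵐ ω ∂ν, 0 ≤ η ω i j) (n : ℕ) (i : Fin d) (t : ℝ) :
    chaosLaplace ν η n i t ≤ 1 :=
  (chaosLaplace_le_exp hm h0 n i t).trans (exp_neg_max_le_one t)

lemma chaosLaplace_antitone (hm : ∀ i j, AEMeasurable (fun ω => η ω i j) ν)
    (h0 : ∀ i j, ∀ᵐ ω ∂ν, 0 ≤ η ω i j) (n : ℕ) (i : Fin d) : Antitone (chaosLaplace ν η n i) :=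
  (chaosLaplace_basic hm h0 n i).2.2

lemma chaosLaplace_succ_le (hm : ∀ i j, AEMeasurable (fun ω => η ω i j) ν)
    (h0 : ∀ i j, ∀ᵐ ω ∂ν, 0 ≤ η ω i j) (n : ℕ) :
    ∀ i t, chaosLaplace ν η (n + 1) i t ≤ chaosLaplace ν η n i t := by
  induction n with
  | zero => intro i t; exact chaosLaplace_le_exp hm h0 1 i t
  | succ n ih =>
    intro i t
    refine mul_le_mul_of_nonneg_left (integral_mono ?_ ?_ fun ω => ?_) (Real.exp_pos _).le
    · exact integrable_prod_comp_mul hm (chaosLaplace_antitone hm h0 _)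
        (chaosLaplace_nonneg hm h0 _) (chaosLaplace_le_one hm h0 _) i _
    · exact integrable_prod_comp_mul hm (chaosLaplace_antitone hm h0 _)
        (chaosLaplace_nonneg hm h0 _) (chaosLaplace_le_one hm h0 _) i _
    · exact Finset.prod_le_prod (fun j _ => chaosLaplace_nonneg hm h0 _ j _) fun j _ => ih j _

lemma bddBelow_range_chaosLaplace (hm : ∀ i j, AEMeasurable (fun ω => η ω i j) ν)
    (h0 : ∀ i j, ∀ᵐ ω ∂ν, 0 ≤ η ω i j) (i : Fin d) (t : ℝ) :
    BddBelow (Set.range fun n => chaosLaplace ν η n i t) :=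
  ⟨0, by rintro _ ⟨n, rfl⟩; exact chaosLaplace_nonneg hm h0 n i t⟩

lemma tendsto_chaosLaplace (hm : ∀ i j, AEMeasurable (fun ω => η ω i j) ν)
    (h0 : ∀ i j, ∀ᵐ ω ∂ν, 0 ≤ η ω i j) (i : Fin d) (t : ℝ) :
    Tendsto (fun n => chaosLaplace ν η n i t) atTop (nhds (chaosLaplaceLimit ν η i t)) :=
  tendsto_atTop_ciInf (antitone_nat_of_succ_le fun n => chaosLaplace_succ_le hm h0 n i t)
    (bddBelow_range_chaosLaplace hm h0 i t)

lemma chaosLaplaceLimit_le (hm : ∀ i j, AEMeasurable (fun ω => η ω i j) ν)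
    (h0 : ∀ i j, ∀ᵐ ω ∂ν, 0 ≤ η ω i j) (n : ℕ) (i : Fin d) (t : ℝ) :
    chaosLaplaceLimit ν η i t ≤ chaosLaplace ν η n i t :=
  ciInf_le (bddBelow_range_chaosLaplace hm h0 i t) n

lemma chaosLaplaceLimit_nonneg (hm : ∀ i j, AEMeasurable (fun ω => η ω i j) ν)
    (h0 : ∀ i j, ∀ᵐ ω ∂ν, 0 ≤ η ω i j) (i : Fin d) (t : ℝ) : 0 ≤ chaosLaplaceLimit ν η i t :=
  le_ciInf fun n => chaosLaplace_nonneg hm h0 n i t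

lemma chaosLaplaceLimit_le_exp (hm : ∀ i j, AEMeasurable (fun ω => η ω i j) ν)
    (h0 : ∀ i j, ∀ᵐ ω ∂ν, 0 ≤ η ω i j) (i : Fin d) (t : ℝ) :
    chaosLaplaceLimit ν η i t ≤ Real.exp (-max t 0) :=
  chaosLaplaceLimit_le hm h0 0 i t

lemma chaosLaplaceLimit_le_one (hm : ∀ i j, AEMeasurable (fun ω => η ω i j) ν)
    (h0 : ∀ i j, ∀ᵐ ω ∂ν, 0 ≤ η ω i j) (i : Fin d) (t : ℝ) :
    chaosLaplaceLimit ν η i t ≤ 1 :=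
  (chaosLaplaceLimit_le_exp hm h0 i t).trans (exp_neg_max_le_one t)

lemma chaosLaplaceLimit_antitone (hm : ∀ i j, AEMeasurable (fun ω => η ω i j) ν)
    (h0 : ∀ i j, ∀ᵐ ω ∂ν, 0 ≤ η ω i j) (i : Fin d) : Antitone (chaosLaplaceLimit ν η i) :=
  fun _ _ hst => le_ciInf fun n =>
    (chaosLaplaceLimit_le hm h0 n i _).trans (chaosLaplace_antitone hm h0 n i hst)

/-- The recursion passes to the limit by dominated convergence; the factor `e^{-t} ≤ 1` is dropped,
as one inequality suffices below. -/
lemma chaosLaplaceLimit_le_integral (hm : ∀ i j, AEMeasurable (fun ω => η ω i j) ν)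
    (h0 : ∀ i j, ∀ᵐ ω ∂ν, 0 ≤ η ω i j) (i : Fin d) {t : ℝ} (ht : 0 ≤ t) :
    chaosLaplaceLimit ν η i t ≤ ∫ ω, ∏ j, chaosLaplaceLimit ν η j (t * η ω i j) ∂ν := by
  have h1 : ∀ n, chaosLaplaceLimit ν η i t ≤
      ∫ ω, ∏ j, chaosLaplace ν η n j (t * η ω i j) ∂ν := by
    intro n
    refine (chaosLaplaceLimit_le hm h0 (n + 1) i t).trans ?_
    rw [chaosLaplace, max_eq_left ht]
    exact mul_le_of_le_one_left (integral_nonneg fun ω =>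
      Finset.prod_nonneg fun j _ => chaosLaplace_nonneg hm h0 n j _)
      (Real.exp_le_one_iff.2 (neg_nonpos.2 ht))
  refine ge_of_tendsto' (x := atTop) ?_ h1
  refine tendsto_integral_of_dominated_convergence (fun _ => 1) (fun n => ?_)
    (integrable_const 1) (fun n => ae_of_all _ fun ω => ?_) (ae_of_all _ fun ω => ?_)
  · exact (integrable_prod_comp_mul hm (chaosLaplace_antitone hm h0 n)
      (chaosLaplace_nonneg hm h0 n) (chaosLaplace_le_one hm h0 n) i t).aestronglyMeasurable
  · rw [Real.norm_eq_abs,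
      abs_of_nonneg (Finset.prod_nonneg fun j _ => chaosLaplace_nonneg hm h0 n j _)]
    exact Finset.prod_le_one (fun j _ => chaosLaplace_nonneg hm h0 n j _)
      fun j _ => chaosLaplace_le_one hm h0 n j _
  · exact tendsto_finsetProd _ fun j _ => tendsto_chaosLaplace hm h0 j _

end

/-! ### The zero-one dichotomy for the limit transform at `0` -/

lemma le_prod_pow_matrix_pow {d : ℕ} {q : Fin d → ℝ} {B : Matrix (Fin d) (Fin d) ℕ}
    (hq0 : ∀ i, 0 ≤ q i) (h : ∀ i, q i ≤ ∏ j, q j ^ B i j) (n : ℕ) :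
    ∀ i, q i ≤ ∏ j, q j ^ (B ^ n) i j := by
  induction n with
  | zero =>
    intro i
    rw [Finset.prod_eq_single i (fun j _ hj => by simp [Matrix.one_apply_ne hj.symm]) (by simp)]
    simp
  | succ n ih =>
    intro i
    calc q i ≤ ∏ k, q k ^ (B ^ n) i k := ih i
      _ ≤ ∏ k, (∏ j, q j ^ B k j) ^ (B ^ n) i k :=
          Finset.prod_le_prod (fun k _ => pow_nonneg (hq0 k) _)
            fun k _ => pow_le_pow_left₀ (hq0 k) (h k) _
      _ = ∏ j, q j ^ (B ^ (n + 1)) i j := by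
          simp_rw [← Finset.prod_pow, pow_succ, Matrix.mul_apply, ← Finset.prod_pow_eq_pow_sum,
            ← pow_mul]
          rw [Finset.prod_comm]
          simp_rw [mul_comm]

/-- The maximum `M` of `q` satisfies `M ≤ M ^ d ≤ M ^ 2`, so it is `0` or `1`; in the latter case
the whole product is at least `1`, hence so is every factor. -/
lemma all_zero_or_all_one_of_le_prod {d : ℕ} (hd : 2 ≤ d) {q : Fin d → ℝ} (hq0 : ∀ i, 0 ≤ q i)
    (hq1 : ∀ i, q i ≤ 1) (h : ∀ i, q i ≤ ∏ j, q j) : (∀ i, q i = 0) ∨ ∀ i, q i = 1 := by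
  have : Nonempty (Fin d) := ⟨⟨0, by omega⟩⟩
  obtain ⟨i₀, hi₀⟩ := Finite.exists_max q
  rcases (hq0 i₀).eq_or_lt with h0 | h0
  · exact Or.inl fun i => le_antisymm ((hi₀ i).trans h0.ge) (hq0 i)
  right
  have h1 : ∏ j, q j ≤ q i₀ ^ 2 :=
    calc ∏ j, q j ≤ ∏ _j : Fin d, q i₀ := Finset.prod_le_prod (fun j _ => hq0 j) fun j _ => hi₀ j
      _ = q i₀ ^ d := by simp
      _ ≤ q i₀ ^ 2 := pow_le_pow_of_le_one (hq0 _) (hq1 _) hd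
  have h2 : 1 ≤ q i₀ := by
    have := (h i₀).trans h1
    nlinarith
  have h3 : 1 ≤ ∏ j, q j := h2.trans (h i₀)
  intro i
  refine le_antisymm (hq1 i) (h3.trans ?_)
  rw [← Finset.mul_prod_erase _ _ (Finset.mem_univ i)]
  exact mul_le_of_le_one_right (hq0 i) (Finset.prod_le_one (fun j _ => hq0 j) fun j _ => hq1 j)

/-- Here `q i`, the supremum of the transform over `t > 0`, stands for the probability that `Z` is
finite. A finite `Z` requires finite sums in all subtrees reached with positive weight, and `B ^ N`
reaches every colour. -/
lemma chaosLaplaceLimit_zero_or_tendsto_one {d : ℕ} {Ω₀ : Type*} [MeasurableSpace Ω₀]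
    {ν : Measure Ω₀} [IsProbabilityMeasure ν] {η : Ω₀ → Matrix (Fin d) (Fin d) ℝ} (hd : 2 ≤ d)
    (hm : ∀ i j, AEMeasurable (fun ω => η ω i j) ν) (h0 : ∀ i j, ∀ᵐ ω ∂ν, 0 ≤ η ω i j)
    {B : Matrix (Fin d) (Fin d) ℕ} (hB : ∀ i j, B i j = 0 ∨ B i j = 1 ∧ ∀ᵐ ω ∂ν, 0 < η ω i j)
    {N : ℕ} (hBN : ∀ i j, (B ^ N) i j ≠ 0) :
    (∀ i, ∀ t > 0, chaosLaplaceLimit ν η i t = 0) ∨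
      ∀ i, Tendsto (chaosLaplaceLimit ν η i) (nhdsWithin 0 (Set.Ioi 0)) (nhds 1) := by
  set φ := chaosLaplaceLimit ν η with hφ
  set q : Fin d → ℝ := fun i => sSup (φ i '' Set.Ioi 0) with hq
  have hbdd : ∀ i, BddAbove (φ i '' Set.Ioi 0) := fun i =>
    ⟨1, by rintro _ ⟨t, -, rfl⟩; exact chaosLaplaceLimit_le_one hm h0 i t⟩
  have hne : ∀ i, (φ i '' Set.Ioi 0).Nonempty := fun i => ⟨φ i 1, 1, by simp, rfl⟩
  have hle : ∀ i, ∀ t > 0, φ i t ≤ q i := fun i t ht => le_csSup (hbdd i) ⟨t, ht, rfl⟩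
  have hq0 : ∀ i, 0 ≤ q i := fun i =>
    (chaosLaplaceLimit_nonneg hm h0 i 1).trans (hle i 1 one_pos)
  have hq1 : ∀ i, q i ≤ 1 := fun i => csSup_le (hne i) (by
    rintro _ ⟨t, -, rfl⟩; exact chaosLaplaceLimit_le_one hm h0 i t)
  have hstep : ∀ i, q i ≤ ∏ j, q j ^ B i j := by
    intro i
    refine csSup_le (hne i) ?_
    rintro _ ⟨t, ht, rfl⟩
    have ht : 0 < t := ht
    refine (chaosLaplaceLimit_le_integral hm h0 i ht.le).trans ?_
    have h1 : ∫ ω, ∏ j, φ j (t * η ω i j) ∂ν ≤ ∫ _ω, ∏ j, q j ^ B i j ∂ν := by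
      refine integral_mono_ae (integrable_prod_comp_mul hm (chaosLaplaceLimit_antitone hm h0)
        (chaosLaplaceLimit_nonneg hm h0) (chaosLaplaceLimit_le_one hm h0) i t)
        (integrable_const _) ?_
      have h2 : ∀ᵐ ω ∂ν, ∀ j, φ j (t * η ω i j) ≤ q j ^ B i j := by
        refine ae_all_iff.2 fun j => ?_
        rcases hB i j with h | ⟨h, hpos⟩
        · exact ae_of_all _ fun ω => by
            rw [h, pow_zero]; exact chaosLaplaceLimit_le_one hm h0 j _
        · filter_upwards [hpos] with ω hω
          rw [h, pow_one]
          exact hle j _ (mul_pos ht hω)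
      filter_upwards [h2] with ω hω
      exact Finset.prod_le_prod (fun j _ => chaosLaplaceLimit_nonneg hm h0 j _) fun j _ => hω j
    simpa using h1
  have hprod : ∀ i, q i ≤ ∏ j, q j := by
    intro i
    refine (le_prod_pow_matrix_pow hq0 hstep N i).trans ?_
    exact Finset.prod_le_prod (fun j _ => pow_nonneg (hq0 j) _)
      fun j _ => pow_le_of_le_one (hq0 j) (hq1 j) (hBN i j)
  rcases all_zero_or_all_one_of_le_prod hd hq0 hq1 hprod with h | h
  · left
    intro i t ht
    exact le_antisymm ((hle i t ht).trans (h i).le) (chaosLaplaceLimit_nonneg hm h0 i t)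
  · right
    intro i
    have := (chaosLaplaceLimit_antitone hm h0 i).tendsto_nhdsGT 0
    rwa [show sSup (chaosLaplaceLimit ν η i '' Set.Ioi 0) = 1 from h i] at this

/-! ### Excluding the limit `1` at `0` -/

/-- Linearises the product for small arguments; `b` is the part of `a` that survives truncation, and
only its sum has to be small. -/
lemma one_sub_mul_sum_le_one_sub_prod {ι : Type*} [Fintype ι] {a b : ι → ℝ} {ε : ℝ}
    (ha : ∀ i, a i ≤ 1) (hb : ∀ i, 0 ≤ b i) (hba : ∀ i, b i ≤ a i) (hε : ∑ i, b i ≤ ε) :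
    (1 - ε) * ∑ i, b i ≤ 1 - ∏ i, (1 - a i) := by
  set S := ∑ i, b i with hS
  have hS0 : 0 ≤ S := Finset.sum_nonneg fun i _ => hb i
  have h1 : ∏ i, (1 - a i) ≤ Real.exp (-S) := by
    rw [hS, ← Finset.sum_neg_distrib, Real.exp_sum]
    refine Finset.prod_le_prod (fun i _ => by linarith [ha i]) fun i _ => ?_
    linarith [Real.add_one_le_exp (-b i), hba i]
  have h2 : Real.exp (-S) * (1 + S) ≤ 1 := by
    rw [Real.exp_neg, inv_mul_le_iff₀ (Real.exp_pos _), mul_one]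
    linarith [Real.add_one_le_exp S]
  -- `(1 - S + S²)(1 + S) = 1 + S³ ≥ 1`.
  have h3 : Real.exp (-S) ≤ 1 - (1 - S) * S :=
    le_of_mul_le_mul_right (by nlinarith [pow_nonneg hS0 3]) (by linarith : 0 < 1 + S)
  nlinarith

lemma half_le_one_sub_exp_neg {s : ℝ} (h0 : 0 ≤ s) (h1 : s ≤ 1) :
    s / 2 ≤ 1 - Real.exp (-s) := by
  have h2 : Real.exp (-s) * (1 + s) ≤ 1 := by
    rw [Real.exp_neg, inv_mul_le_iff₀ (Real.exp_pos _), mul_one]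
    linarith [Real.add_one_le_exp s]
  nlinarith [Real.exp_pos (-s)]

lemma tendsto_setLIntegral_Icc_exp (L : Measure ℝ) (f : ℝ → ℝ≥0∞) :
    Tendsto (fun n : ℕ => ∫⁻ s in Set.Icc (Real.exp (-n)) (Real.exp n), f s ∂L) atTop
      (nhds (∫⁻ s in Set.Ioi 0, f s ∂L)) := by
  have hmono : Monotone fun n : ℕ => Set.Icc (Real.exp (-n)) (Real.exp n) := by
    intro m n hmn
    have : (m : ℝ) ≤ n := by exact_mod_cast hmn
    exact Set.Icc_subset_Icc (Real.exp_le_exp.2 (by linarith)) (Real.exp_le_exp.2 this)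
  have hU : ⋃ n : ℕ, Set.Icc (Real.exp (-n)) (Real.exp n) = Set.Ioi 0 := by
    ext s
    simp only [Set.mem_iUnion, Set.mem_Icc, Set.mem_Ioi]
    refine ⟨fun ⟨_, h⟩ => (Real.exp_pos _).trans_le h.1, fun h => ?_⟩
    obtain ⟨n, hn⟩ := exists_nat_ge |Real.log s|
    obtain ⟨h1, h2⟩ := abs_le.1 hn
    exact ⟨n, (Real.le_log_iff_exp_le h).1 h1, (Real.log_le_iff_le_exp h).1 h2⟩
  have h1 := tendsto_measure_iUnion_atTop (μ := L.withDensity f) hmono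
  rw [hU, withDensity_apply _ measurableSet_Ioi] at h1
  refine h1.congr fun n => ?_
  simp only [Function.comp]
  rw [withDensity_apply _ measurableSet_Icc]

/-- Applies the convolution argument to `u ↦ 1 - φ i (e^u)`. The moments in `hM` run over `s > 0`
only, since an entry equal to `0` has no logarithm. -/
lemma not_tendsto_chaosLaplaceLimit_one {d : ℕ} [Nonempty (Fin d)] {Ω₀ : Type*}
    [MeasurableSpace Ω₀] {ν : Measure Ω₀} [IsProbabilityMeasure ν]
    {η : Ω₀ → Matrix (Fin d) (Fin d) ℝ} (hm : ∀ i j, AEMeasurable (fun ω => η ω i j) ν)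
    (h0 : ∀ i j, ∀ᵐ ω ∂ν, 0 ≤ η ω i j)
    (hM : ∀ x ∈ Set.Icc (0 : ℝ) 1, ∃ l : Fin d → ℝ, (∀ i, 0 < l i) ∧ ∃ μ : ℝ, 1 < μ ∧
      ∀ j, ENNReal.ofReal (μ * l j) ≤ ∑ i, ENNReal.ofReal (l i) *
        ∫⁻ s in Set.Ioi 0, ENNReal.ofReal (s ^ x) ∂(ν.map fun ω => η ω i j)) :
    ¬ ∀ i, Tendsto (chaosLaplaceLimit ν η i) (nhdsWithin 0 (Set.Ioi 0)) (nhds 1) := by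
  intro hlim
  set φ := chaosLaplaceLimit ν η with hφ
  have hφ0 : ∀ i t, 0 ≤ φ i t := chaosLaplaceLimit_nonneg hm h0
  have hφ1 : ∀ i t, φ i t ≤ 1 := chaosLaplaceLimit_le_one hm h0
  have hφa : ∀ i, Antitone (φ i) := chaosLaplaceLimit_antitone hm h0
  set L : Fin d → Fin d → Measure ℝ := fun i j => ν.map fun ω => η ω i j with hL
  have hGm : ∀ i, Measurable fun u => ENNReal.ofReal (1 - φ i (Real.exp u)) := fun i =>
    (measurable_const.sub ((hφa i).measurable.comp Real.measurable_exp)).ennreal_ofReal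
  refine false_of_convolution_supersolution
    (G := fun i u => ENNReal.ofReal (1 - φ i (Real.exp u))) hGm
    (fun i u => ENNReal.ofReal_le_one.2 (by linarith [hφ0 i (Real.exp u)])) ?_ ?_
  · obtain ⟨i⟩ := ‹Nonempty (Fin d)›
    refine ⟨i, top_le_iff.1 ?_⟩
    -- The bound `1 - φ i (e^u) ≥ e^u / 2` exactly cancels the weight `e^{-u}`.
    have h1 : ∫⁻ _u in Set.Iic (0 : ℝ), ENNReal.ofReal (1 / 2) = ∞ := by
      rw [setLIntegral_const, Real.volume_Iic, ENNReal.mul_top (by simp)]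
    rw [← h1]
    refine setLIntegral_mono' measurableSet_Iic fun u hu => ?_
    rw [← ENNReal.ofReal_mul (by linarith [hφ1 i (Real.exp u)])]
    refine ENNReal.ofReal_le_ofReal ?_
    have h2 := half_le_one_sub_exp_neg (Real.exp_pos u).le (Real.exp_le_one_iff.2 hu)
    have h3 := chaosLaplaceLimit_le_exp hm h0 i (Real.exp u)
    rw [max_eq_left (Real.exp_pos u).le] at h3
    calc (1 : ℝ) / 2 = Real.exp u / 2 * Real.exp (-(1 * u)) := by
          rw [one_mul, Real.exp_neg]; field_simp
      _ ≤ _ := mul_le_mul_of_nonneg_right (by linarith) (Real.exp_pos _).le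
  · intro x hx
    obtain ⟨l, hl, μ, hμ, hlμ⟩ := hM x hx
    -- The gap between `μ` and `μ₁` pays for truncating the moments, the gap between `μ₁` and `c`
    -- for the linearisation factor `δ = c / μ₁`.
    obtain ⟨μ₁, hμ₁, hμ₁μ⟩ := exists_between hμ
    obtain ⟨c, hc, hcμ₁⟩ := exists_between hμ₁
    have hev : ∀ᶠ n : ℕ in atTop, ∀ j, ENNReal.ofReal (μ₁ * l j) < ∑ i, ENNReal.ofReal (l i) *
        ∫⁻ s in Set.Icc (Real.exp (-n)) (Real.exp n), ENNReal.ofReal (s ^ x) ∂(L i j) := by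
      refine eventually_all.2 fun j => ?_
      have h1 : Tendsto (fun n : ℕ => ∑ i, ENNReal.ofReal (l i) *
          ∫⁻ s in Set.Icc (Real.exp (-n)) (Real.exp n), ENNReal.ofReal (s ^ x) ∂(L i j)) atTop
          (nhds (∑ i, ENNReal.ofReal (l i) *
            ∫⁻ s in Set.Ioi 0, ENNReal.ofReal (s ^ x) ∂(L i j))) :=
        tendsto_finsetSum _ fun i _ => ENNReal.Tendsto.const_mul
          (tendsto_setLIntegral_Icc_exp _ _) (Or.inr ENNReal.ofReal_ne_top)
      refine h1.eventually (lt_mem_nhds (lt_of_lt_of_le ?_ (hlμ j)))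
      have := hl j
      exact (ENNReal.ofReal_lt_ofReal_iff (by positivity)).2 (by nlinarith)
    obtain ⟨n, hn, hn1⟩ := (hev.and (eventually_ge_atTop 1)).exists
    set k : ℝ := (n : ℝ) with hk
    have hk0 : 0 < k := by rw [hk]; exact_mod_cast hn1
    set δ : ℝ := c / μ₁ with hδ
    have hδ0 : 0 < δ := by positivity
    have hδ1 : δ < 1 := (div_lt_one (by linarith)).2 hcμ₁
    have hd0 : (0 : ℝ) < Fintype.card (Fin d) := by exact_mod_cast Fintype.card_pos
    have hsmall : ∀ᶠ t in nhdsWithin (0 : ℝ) (Set.Ioi 0), ∀ j,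
        1 - (1 - δ) / Fintype.card (Fin d) < φ j t := by
      refine eventually_all.2 fun j => (hlim j).eventually (lt_mem_nhds ?_)
      have : 0 < (1 - δ) / Fintype.card (Fin d) := div_pos (by linarith) hd0
      linarith
    obtain ⟨t₀, ht₀, ht₀0⟩ := (hsmall.and self_mem_nhdsWithin).exists
    have ht₀0 : 0 < t₀ := ht₀0
    set I : Set ℝ := Set.Icc (Real.exp (-k)) (Real.exp k) with hI
    have hWint : ∀ i j, ∀ F : ℝ → ℝ≥0∞, Measurable F →
        ∫⁻ h, F h ∂(ENNReal.ofReal δ • ((L i j).restrict I).map Real.log) =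
          ENNReal.ofReal δ * ∫⁻ s in I, F (Real.log s) ∂(L i j) := by
      intro i j F hF
      rw [lintegral_smul_measure, lintegral_map hF Real.measurable_log, smul_eq_mul]
    -- The measures are `δ` times the laws of `log η_ij` cut to `[-k, k]`. For `u ≤ log t₀ - k` and
    -- `η_ij ≤ e^k` the argument `e^u η_ij` stays below `t₀`, where the linearisation is valid.
    refine ⟨k, hk0, min 0 (Real.log t₀ - k), min_le_left _ _,
      fun i j => ENNReal.ofReal δ • ((L i j).restrict I).map Real.log,
      fun i => ENNReal.ofReal (l i), c, hc, fun i j => inferInstance, fun i j => ?_,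
      fun i u hu => ?_, fun j => ⟨by simpa using hl j, ENNReal.ofReal_ne_top⟩, fun j => ?_⟩
    · refine Measure.ae_smul_measure ?_ _
      rw [ae_map_iff Real.measurable_log.aemeasurable (measurableSet_le (by fun_prop) (by fun_prop))]
      refine (ae_restrict_iff' measurableSet_Icc).2 (ae_of_all _ fun s hs => ?_)
      have hs0 : 0 < s := (Real.exp_pos _).trans_le hs.1
      exact abs_le.2 ⟨(Real.le_log_iff_exp_le hs0).2 hs.1, (Real.log_le_iff_le_exp hs0).2 hs.2⟩
    · have h1 : ∀ j, ∫⁻ h, ENNReal.ofReal (1 - φ j (Real.exp (u + h)))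
          ∂(ENNReal.ofReal δ • ((L i j).restrict I).map Real.log) =
          ∫⁻ ω, ENNReal.ofReal (δ * I.indicator (fun s => 1 - φ j (Real.exp u * s)) (η ω i j))
            ∂ν := by
        intro j
        rw [hWint i j (fun h => ENNReal.ofReal (1 - φ j (Real.exp (u + h))))
            ((hGm j).comp (measurable_const_add u)),
          ← lintegral_indicator measurableSet_Icc, ← lintegral_const_mul' _ _ ENNReal.ofReal_ne_top,
          hL, lintegral_map' ?_ (hm i j)]
        · refine lintegral_congr fun ω => ?_
          by_cases hω : η ω i j ∈ I
          · have hs0 : 0 < η ω i j := (Real.exp_pos _).trans_le hω.1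
            rw [Set.indicator_of_mem hω, Set.indicator_of_mem hω, Real.exp_add,
              Real.exp_log hs0, ENNReal.ofReal_mul hδ0.le]
          · rw [Set.indicator_of_notMem hω, Set.indicator_of_notMem hω]
            simp
        · exact ((((hGm j).comp (measurable_const_add u)).comp
            Real.measurable_log).indicator measurableSet_Icc).const_mul _ |>.aemeasurable
      simp_rw [h1]
      rw [← lintegral_finsetSum' _ fun j _ => ?_]
      · have hint := integrable_prod_comp_mul hm hφa hφ0 hφ1 i (Real.exp u)
        have hint' : Integrable (fun ω => 1 - ∏ j, φ j (Real.exp u * η ω i j)) ν :=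
          (integrable_const 1).sub hint
        calc ∫⁻ ω, ∑ j, ENNReal.ofReal
              (δ * I.indicator (fun s => 1 - φ j (Real.exp u * s)) (η ω i j)) ∂ν
            ≤ ∫⁻ ω, ENNReal.ofReal (1 - ∏ j, φ j (Real.exp u * η ω i j)) ∂ν := by
              refine lintegral_mono fun ω => ?_
              have hb0 : ∀ j, 0 ≤ I.indicator (fun s => 1 - φ j (Real.exp u * s)) (η ω i j) :=
                fun j => Set.indicator_nonneg (fun s _ => by linarith [hφ1 j (Real.exp u * s)]) _
              rw [← ENNReal.ofReal_sum_of_nonneg fun j _ => mul_nonneg hδ0.le (hb0 j),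
                ← Finset.mul_sum]
              refine ENNReal.ofReal_le_ofReal ?_
              have h2 := one_sub_mul_sum_le_one_sub_prod (ε := 1 - δ)
                (a := fun j => 1 - φ j (Real.exp u * η ω i j))
                (b := fun j => I.indicator (fun s => 1 - φ j (Real.exp u * s)) (η ω i j))
                (fun j => by linarith [hφ0 j (Real.exp u * η ω i j)]) hb0
                (fun j => Set.indicator_apply_le' (fun _ => le_rfl) fun _ => by
                  linarith [hφ1 j (Real.exp u * η ω i j)]) ?_
              · simpa using h2
              · have h3 : ∀ j, I.indicator (fun s => 1 - φ j (Real.exp u * s)) (η ω i j) ≤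
                    (1 - δ) / Fintype.card (Fin d) := by
                  intro j
                  refine Set.indicator_apply_le' (fun hω => ?_) fun _ =>
                    div_nonneg (by linarith) hd0.le
                  have h4 : Real.exp u * η ω i j ≤ t₀ := by
                    calc Real.exp u * η ω i j ≤ Real.exp (Real.log t₀ - k) * Real.exp k :=
                          mul_le_mul (Real.exp_le_exp.2 (hu.trans (min_le_right _ _))) hω.2
                            ((Real.exp_pos _).le.trans hω.1) (Real.exp_pos _).le
                      _ = t₀ := by rw [← Real.exp_add, sub_add_cancel, Real.exp_log ht₀0]
                  linarith [hφa j h4, ht₀ j]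
                calc ∑ j, I.indicator (fun s => 1 - φ j (Real.exp u * s)) (η ω i j)
                    ≤ ∑ _j : Fin d, (1 - δ) / Fintype.card (Fin d) :=
                      Finset.sum_le_sum fun j _ => h3 j
                  _ = 1 - δ := by
                      rw [Finset.sum_const, nsmul_eq_mul, Finset.card_univ]
                      field_simp
          _ = ENNReal.ofReal (∫ ω, (1 - ∏ j, φ j (Real.exp u * η ω i j)) ∂ν) := by
              rw [ofReal_integral_eq_lintegral_ofReal hint']
              exact ae_of_all _ fun ω => sub_nonneg.2
                (Finset.prod_le_one (fun j _ => hφ0 j _) fun j _ => hφ1 j _)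
          _ ≤ _ := by
              refine ENNReal.ofReal_le_ofReal ?_
              rw [integral_sub (integrable_const 1) hint]
              have := chaosLaplaceLimit_le_integral hm h0 i (Real.exp_pos u).le
              simp only [integral_const, probReal_univ, smul_eq_mul, mul_one]
              linarith
      · have h2 : Measurable (I.indicator fun s => 1 - φ j (Real.exp u * s)) :=
          (measurable_const.sub ((hφa j).measurable.comp
            (measurable_const_mul _))).indicator measurableSet_Icc
        exact ((h2.comp_aemeasurable (hm i j)).const_mul δ).ennreal_ofReal
    · have h1 : ∀ i, ∫⁻ h, ENNReal.ofReal (Real.exp (x * h))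
          ∂(ENNReal.ofReal δ • ((L i j).restrict I).map Real.log) =
          ENNReal.ofReal δ * ∫⁻ s in I, ENNReal.ofReal (s ^ x) ∂(L i j) := by
        intro i
        rw [hWint i j _ (by fun_prop)]
        congr 1
        refine setLIntegral_congr_fun measurableSet_Icc fun s hs => ?_
        have hs0 : 0 < s := (Real.exp_pos _).trans_le hs.1
        rw [Real.rpow_def_of_pos hs0, mul_comm]
      simp_rw [h1, mul_left_comm _ (ENNReal.ofReal δ), ← Finset.mul_sum]
      calc ENNReal.ofReal c * ENNReal.ofReal (l j)
          = ENNReal.ofReal δ * ENNReal.ofReal (μ₁ * l j) := by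
            rw [← ENNReal.ofReal_mul (by linarith), ← ENNReal.ofReal_mul hδ0.le, hδ]
            congr 1
            field_simp
        _ ≤ _ := mul_le_mul_right (hn j).le _

/-! ### From the spectral condition to a vanishing transform -/

lemma one_lt_largestEigenvalue_of_one_lt_chaosLambda {d : ℕ} {Ω₀ : Type*} [MeasurableSpace Ω₀]
    {ν : Measure Ω₀} {η : Ω₀ → Matrix (Fin d) (Fin d) ℝ} (hlam : 1 < chaosLambda ν η)
    {x : ℝ} (hx : x ∈ Set.Icc (0 : ℝ) 1) : 1 < largestEigenvalue (momentMatrix ν η x) := by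
  unfold chaosLambda at hlam
  by_cases hb : BddBelow (Set.range fun x : Set.Icc (0 : ℝ) 1 =>
      largestEigenvalue (momentMatrix ν η (x : ℝ)))
  · exact hlam.trans_le (ciInf_le hb ⟨x, hx⟩)
  -- An infimum of a family unbounded below has the default value `0`, which is not above `1`.
  · rw [Real.iInf_of_not_bddBelow hb] at hlam
    linarith

/-- For `d = 1` the matrix `m(0)` is the `1 × 1` identity, with only eigenvalue `1`. -/
lemma two_le_of_one_lt_chaosLambda {d : ℕ} {Ω₀ : Type*} [MeasurableSpace Ω₀]
    {ν : Measure Ω₀} [IsProbabilityMeasure ν] {η : Ω₀ → Matrix (Fin d) (Fin d) ℝ}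
    (hlam : 1 < chaosLambda ν η) (α : Fin d) : 2 ≤ d := by
  by_contra hd
  obtain rfl : d = 1 := by have := α.isLt; omega
  obtain ⟨μ, hμ, he⟩ := exists_hasEigenvalue_of_one_lt_largestEigenvalue
    (one_lt_largestEigenvalue_of_one_lt_chaosLambda hlam (Set.left_mem_Icc.2 zero_le_one))
  obtain ⟨v, hv, hvm⟩ := exists_vecMul_eq_smul_of_hasEigenvalue he
  have h1 := congrFun hvm 0
  have h2 : v 0 ≠ 0 := fun h => hv (funext fun i => by rw [Subsingleton.elim i 0, h]; rfl)
  simp only [Matrix.vecMul, dotProduct, Finset.univ_unique, Fin.default_eq_zero,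
    Finset.sum_singleton, momentMatrix, Matrix.of_apply, Real.rpow_zero, integral_const,
    probReal_univ, smul_eq_mul, mul_one, Pi.smul_apply] at h1
  have h3 : (μ - 1) * v 0 = 0 := by linarith
  rcases mul_eq_zero.1 h3 with h | h
  · linarith
  · exact h2 h

lemma matrix_pow_apply_eq_zero {ι R S : Type*} [Fintype ι] [DecidableEq ι] [Semiring R]
    [Semiring S] [PartialOrder R] [CanonicallyOrderedAdd R] [IsOrderedRing R] [NoZeroDivisors R]
    [Nontrivial R]
    {B : Matrix ι ι R} {m : Matrix ι ι S}
    (h : ∀ i j, B i j = 0 → m i j = 0) (n : ℕ) : ∀ i j, (B ^ n) i j = 0 → (m ^ n) i j = 0 := by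
  induction n with
  | zero =>
    intro i j hij
    rw [pow_zero, Matrix.one_apply] at hij ⊢
    split_ifs at hij ⊢ with hi
    · exact absurd hij one_ne_zero
    · rfl
  | succ n ih =>
    intro i j hij
    rw [pow_succ, Matrix.mul_apply] at hij ⊢
    rw [Finset.sum_eq_zero_iff] at hij
    refine Finset.sum_eq_zero fun k hk => ?_
    rcases mul_eq_zero.1 (hij k hk) with h1 | h1
    · rw [ih i k h1, zero_mul]
    · rw [h k j h1, mul_zero]

lemma ofReal_integral_le_lintegral_ofReal {X : Type*} [MeasurableSpace X] {μ : Measure X}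
    {f : X → ℝ} (hf : 0 ≤ᵐ[μ] f) : ENNReal.ofReal (∫ x, f x ∂μ) ≤ ∫⁻ x, ENNReal.ofReal (f x) ∂μ := by
  by_cases h : Integrable f μ
  · exact (ofReal_integral_eq_lintegral_ofReal h hf).le
  · rw [integral_undef h, ENNReal.ofReal_zero]
    exact zero_le

/-- If `λ > 1`, the Laplace transform of `lim Zₙ` vanishes on `(0, ∞)`. -/
theorem chaosLaplaceLimit_eq_zero {d : ℕ} {Ω₀ : Type*} [MeasurableSpace Ω₀]
    {ν : Measure Ω₀} [IsProbabilityMeasure ν] {η : Ω₀ → Matrix (Fin d) (Fin d) ℝ}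
    (hm : ∀ i j, AEMeasurable (fun ω => η ω i j) ν)
    (hη_atom : ∀ i j, (∀ᵐ ω ∂ν, η ω i j = 0) ∨ (∀ᵐ ω ∂ν, 0 < η ω i j))
    (hη_reg : ∃ N : ℕ, ∀ x ∈ Set.Icc (0 : ℝ) 1, ∀ i j, 0 < (momentMatrix ν η x ^ N) i j)
    (hlam : 1 < chaosLambda ν η) (α : Fin d) {t : ℝ} (ht : 0 < t) :
    chaosLaplaceLimit ν η α t = 0 := by
  classical
  have hd := two_le_of_one_lt_chaosLambda hlam α
  have : Nonempty (Fin d) := ⟨α⟩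
  obtain ⟨N, hN⟩ := hη_reg
  have h0 : ∀ i j, ∀ᵐ ω ∂ν, 0 ≤ η ω i j := fun i j => by
    rcases hη_atom i j with h | h
    · exact h.mono fun ω hω => hω.ge
    · exact h.mono fun ω hω => hω.le
  set B : Matrix (Fin d) (Fin d) ℕ :=
    Matrix.of fun i j => if ∀ᵐ ω ∂ν, 0 < η ω i j then 1 else 0 with hBdef
  have hB : ∀ i j, B i j = 0 ∨ B i j = 1 ∧ ∀ᵐ ω ∂ν, 0 < η ω i j := by
    intro i j
    by_cases h : ∀ᵐ ω ∂ν, 0 < η ω i j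
    · exact Or.inr ⟨by rw [hBdef, Matrix.of_apply, if_pos h], h⟩
    · exact Or.inl (by rw [hBdef, Matrix.of_apply, if_neg h])
  have hBm : ∀ i j, B i j = 0 → momentMatrix ν η 1 i j = 0 := by
    intro i j h
    have h1 : ∀ᵐ ω ∂ν, η ω i j = 0 := by
      refine (hη_atom i j).resolve_right fun hpos => ?_
      rw [hBdef, Matrix.of_apply, if_pos hpos] at h
      exact one_ne_zero h
    rw [momentMatrix, Matrix.of_apply]
    refine integral_eq_zero_of_ae (h1.mono fun ω hω => ?_)
    simp [hω]
  -- Regularity is read off at `x = 1`; at `x = 0` the convention `0^0 = 1` hides the zero entries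
  -- of `η`.
  have hBN : ∀ i j, (B ^ N) i j ≠ 0 := fun i j h =>
    (hN 1 (by simp) i j).ne' (matrix_pow_apply_eq_zero hBm N i j h)
  refine (chaosLaplaceLimit_zero_or_tendsto_one hd hm h0 hB hBN).elim (fun h => h α t ht)
    fun h => absurd h (not_tendsto_chaosLaplaceLimit_one hm h0 ?_)
  have key : ∀ (x : ℝ) (A : Matrix (Fin d) (Fin d) ℝ), (∀ i j, 0 ≤ A i j) →
      (∀ i j, ENNReal.ofReal (A i j) ≤
        ∫⁻ s in Set.Ioi 0, ENNReal.ofReal (s ^ x) ∂(ν.map fun ω => η ω i j)) →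
      (∃ l : Fin d → ℝ, (∀ i, 0 < l i) ∧ ∃ μ : ℝ, 1 < μ ∧ ∀ j, μ * l j ≤ ∑ i, l i * A i j) →
      ∃ l : Fin d → ℝ, (∀ i, 0 < l i) ∧ ∃ μ : ℝ, 1 < μ ∧
        ∀ j, ENNReal.ofReal (μ * l j) ≤ ∑ i, ENNReal.ofReal (l i) *
          ∫⁻ s in Set.Ioi 0, ENNReal.ofReal (s ^ x) ∂(ν.map fun ω => η ω i j) := by
    rintro x A hA0 hA ⟨l, hl, μ, hμ, h⟩
    refine ⟨l, hl, μ, hμ, fun j => (ENNReal.ofReal_le_ofReal (h j)).trans ?_⟩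
    rw [ENNReal.ofReal_sum_of_nonneg fun i _ => mul_nonneg (hl i).le (hA0 i j)]
    refine Finset.sum_le_sum fun i _ => ?_
    rw [ENNReal.ofReal_mul (hl i).le]
    exact mul_le_mul_right (hA i j) _
  have hint : ∀ (x : ℝ) i j, ∫⁻ s in Set.Ioi 0, ENNReal.ofReal (s ^ x) ∂(ν.map fun ω => η ω i j) =
      ∫⁻ ω, (Set.Ioi (0 : ℝ)).indicator (fun s => ENNReal.ofReal (s ^ x)) (η ω i j) ∂ν := by
    intro x i j
    have h1 : Measurable fun s : ℝ => ENNReal.ofReal (s ^ x) := by fun_prop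
    rw [← lintegral_indicator measurableSet_Ioi,
      lintegral_map' (h1.indicator measurableSet_Ioi).aemeasurable (hm i j)]
  intro x hx
  rcases hx.1.eq_or_lt with rfl | hx0
  -- At `x = 0` the moments over `s > 0` form the support matrix `B`, not `m(0)`, whose entries are
  -- all `1`; so the growth factor comes from `d ≥ 2` and `B ^ N ≥ 1` instead of `ρ(0)`.
  · refine key 0 ((Nat.castRingHom ℝ).mapMatrix B) (fun i j => by simp) (fun i j => ?_)
      (exists_pos_vecMul_ge_of_one_le_pow hd (N := N) (fun i j => by simp) fun i j => ?_)
    · refine le_of_le_of_eq ?_ (hint 0 i j).symm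
      rcases hB i j with h | ⟨h, hpos⟩
      · simp [h]
      · have h1 : ∫⁻ ω, (Set.Ioi (0 : ℝ)).indicator (fun s => ENNReal.ofReal (s ^ (0 : ℝ)))
            (η ω i j) ∂ν = ∫⁻ _ω, 1 ∂ν := by
          refine lintegral_congr_ae (hpos.mono fun ω hω => ?_)
          exact (Set.indicator_of_mem (Set.mem_Ioi.2 hω) _).trans (by simp)
        rw [h1]
        simp [h]
    · rw [← map_pow]
      simpa using Nat.one_le_iff_ne_zero.2 (hBN i j)
  · have hm0 : ∀ i j, 0 ≤ momentMatrix ν η x i j := fun i j =>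
      integral_nonneg_of_ae ((h0 i j).mono fun ω hω => Real.rpow_nonneg hω _)
    refine key x (momentMatrix ν η x) hm0 (fun i j => ?_)
      (exists_pos_vecMul_ge_of_largestEigenvalue hm0 (hN x hx)
        (one_lt_largestEigenvalue_of_one_lt_chaosLambda hlam hx))
    refine le_of_le_of_eq ?_ (hint x i j).symm
    refine (ofReal_integral_le_lintegral_ofReal
      ((h0 i j).mono fun ω hω => Real.rpow_nonneg hω _)).trans (lintegral_mono_ae ?_)
    filter_upwards [h0 i j] with ω hω
    rcases hω.eq_or_lt with h | h
    · rw [← h, Real.zero_rpow hx0.ne']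
      simp
    · rw [Set.indicator_of_mem (Set.mem_Ioi.2 h)]

/-! ### Recursive structure of the chaos -/

section

variable {d : ℕ}

lemma sum_vector_succ_cons {M : Type*} [AddCommMonoid M] (f : TreeVertex d → M) (n : ℕ) :
    ∑ v : List.Vector (Fin d) (n + 1), f v.toList =
      ∑ j, ∑ v : List.Vector (Fin d) n, f (j :: v.toList) := by
  rw [← Fintype.sum_prod_type']
  refine (Fintype.sum_equiv ⟨fun p => p.1 ::ᵥ p.2, fun v => (v.head, v.tail), fun p => by simp,
    fun v => by simp⟩ _ _ fun p => ?_).symm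
  simp [List.Vector.toList_cons]

/-- Words are stored last letter first, so the end of the list is the first step from the root: this
sum splits a level among the subtrees of the root's children. -/
lemma sum_vector_succ_snoc {M : Type*} [AddCommMonoid M] (n : ℕ) : ∀ f : TreeVertex d → M,
    ∑ v : List.Vector (Fin d) (n + 1), f v.toList =
      ∑ j, ∑ v : List.Vector (Fin d) n, f (v.toList ++ [j]) := by
  induction n with
  | zero =>
    intro f
    rw [sum_vector_succ_cons]
    refine Finset.sum_congr rfl fun j _ => Finset.sum_congr rfl fun v _ => ?_
    rw [Subsingleton.elim v List.Vector.nil]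
    rfl
  | succ n ih =>
    intro f
    rw [sum_vector_succ_cons]
    simp_rw [fun i => ih fun w => f (i :: w)]
    rw [Finset.sum_comm]
    refine Finset.sum_congr rfl fun j _ => ?_
    rw [sum_vector_succ_cons fun w => f (w ++ [j])]
    rfl

/-- The environment on the subtree rooted at the child `j` of the root. -/
def subtreeEnvironment {β : Type*} (ξ : TreeVertex d → β) (j : Fin d) : TreeVertex d → β :=
  fun w => ξ (w ++ [j])

lemma pathWeight_append_singleton (ξ : TreeVertex d → ℝ) (w : TreeVertex d) (j : Fin d) :
    pathWeight ξ (w ++ [j]) = ξ [j] * pathWeight (subtreeEnvironment ξ j) w := by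
  induction w with
  | nil => simp [pathWeight]
  | cons i w ih =>
    rw [List.cons_append, pathWeight, ih, pathWeight, mul_assoc]
    rfl

lemma chaosY_zero (ξ : TreeVertex d → ℝ) : chaosY ξ 0 = 1 := by
  unfold chaosY
  rw [Fintype.sum_subsingleton _ List.Vector.nil]
  rfl

lemma chaosY_succ (ξ : TreeVertex d → ℝ) (n : ℕ) :
    chaosY ξ (n + 1) = ∑ j, ξ [j] * chaosY (subtreeEnvironment ξ j) n := by
  unfold chaosY
  rw [sum_vector_succ_snoc n (pathWeight ξ)]
  refine Finset.sum_congr rfl fun j _ => ?_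
  rw [Finset.mul_sum]
  exact Finset.sum_congr rfl fun v _ => pathWeight_append_singleton ξ v.toList j

lemma chaosZ_zero (ξ : TreeVertex d → ℝ) : chaosZ ξ 0 = 1 := by
  simp [chaosZ, chaosY_zero]

lemma chaosZ_succ (ξ : TreeVertex d → ℝ) (n : ℕ) :
    chaosZ ξ (n + 1) = 1 + ∑ j, ξ [j] * chaosZ (subtreeEnvironment ξ j) n := by
  unfold chaosZ
  rw [Finset.sum_range_succ', chaosY_zero, add_comm]
  congr 1
  simp_rw [chaosY_succ, Finset.mul_sum]
  exact Finset.sum_comm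

lemma pathWeight_congr {ξ ζ : TreeVertex d → ℝ} (h : ∀ j u, ξ (j :: u) = ζ (j :: u)) :
    ∀ v, pathWeight ξ v = pathWeight ζ v
  | [] => rfl
  | j :: u => by rw [pathWeight, pathWeight, pathWeight_congr h u, h]

lemma chaosZ_congr {ξ ζ : TreeVertex d → ℝ} (h : ∀ j u, ξ (j :: u) = ζ (j :: u)) (n : ℕ) :
    chaosZ ξ n = chaosZ ζ n := by
  unfold chaosZ chaosY
  simp_rw [pathWeight_congr h]

lemma pathWeight_nonneg {ξ : TreeVertex d → ℝ} (h : ∀ j u, 0 ≤ ξ (j :: u)) :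
    ∀ v, 0 ≤ pathWeight ξ v
  | [] => zero_le_one
  | j :: u => mul_nonneg (pathWeight_nonneg h u) (h j u)

lemma chaosZ_mono {ξ : TreeVertex d → ℝ} (h : ∀ j u, 0 ≤ ξ (j :: u)) : Monotone (chaosZ ξ) := by
  refine monotone_nat_of_le_succ fun n => ?_
  unfold chaosZ
  rw [Finset.sum_range_succ _ (n + 1)]
  exact le_add_of_nonneg_right (Finset.sum_nonneg fun v _ => pathWeight_nonneg h _)

/-- The environment with given rows: `r u j` is the value at the edge from `u` to `j :: u`. -/
def rowEnvironment (r : TreeVertex d → Fin d → ℝ) : TreeVertex d → ℝ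
  | [] => 1
  | j :: u => r u j

lemma chaosZ_rowEnvironment_succ (r : TreeVertex d → Fin d → ℝ) (n : ℕ) :
    chaosZ (rowEnvironment r) (n + 1) =
      1 + ∑ j, r [] j * chaosZ (rowEnvironment (subtreeEnvironment r j)) n := by
  rw [chaosZ_succ]
  congr 1
  refine Finset.sum_congr rfl fun j _ => ?_
  congr 1
  refine chaosZ_congr (fun i u => ?_) n
  rfl

lemma measurable_chaosZ_rowEnvironment (n : ℕ) :
    Measurable fun r : TreeVertex d → Fin d → ℝ => chaosZ (rowEnvironment r) n := by
  have h1 : ∀ v : TreeVertex d,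
      Measurable fun r : TreeVertex d → Fin d → ℝ => pathWeight (rowEnvironment r) v := by
    intro v
    induction v with
    | nil => exact measurable_const
    | cons j u ih =>
      exact ih.mul ((measurable_pi_apply j).comp (measurable_pi_apply u))
  exact Finset.measurable_fun_sum _ fun k _ => Finset.measurable_fun_sum _ fun v _ => h1 _

lemma vertexColour_append_singleton (α j : Fin d) (u : TreeVertex d) :
    vertexColour α (u ++ [j]) = vertexColour j u := by
  cases u <;> rfl

end

/-! ### Grouping independent families -/

/-- Independence means that the joint law is a product measure, and a product over a sigma type is
an iterated product. -/
lemma iIndepFun_curry {Ω : Type*} [MeasurableSpace Ω] {P : Measure Ω} {ι : Type*}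
    {κ : ι → Type*} {𝓧 : (i : ι) → κ i → Type*} {m𝓧 : ∀ i j, MeasurableSpace (𝓧 i j)}
    {X : (i : ι) → (j : κ i) → Ω → 𝓧 i j} (mX : ∀ i j, Measurable (X i j))
    (h : iIndepFun (fun (p : (i : ι) × (κ i)) ω => X p.1 p.2 ω) P) :
    iIndepFun (fun i ω => (X i · ω)) P := by
  have := h.isProbabilityMeasure
  have : ∀ i j, IsProbabilityMeasure (P.map (X i j)) :=
    fun i j => Measure.isProbabilityMeasure_map (mX i j).aemeasurable
  have hc : (MeasurableEquiv.piCurry 𝓧) ∘ (fun ω p => X p.1 p.2 ω) = fun ω i j => X i j ω := by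
    ext; simp [Sigma.curry]
  have h1 := (iIndepFun_iff_map_fun_eq_infinitePi_map (by fun_prop)).1 h
  rw [iIndepFun_iff_map_fun_eq_infinitePi_map (by fun_prop), ← hc,
    ← Measure.map_map (by fun_prop) (by fun_prop), h1,
    Measure.infinitePi_map_piCurry (fun i j => P.map (X i j))]
  congr 1
  funext i
  have h2 : iIndepFun (X i) P :=
    h.precomp (g := fun j : κ i => (⟨i, j⟩ : (i : ι) × κ i)) sigma_mk_injective
  rw [(iIndepFun_iff_map_fun_eq_infinitePi_map (by fun_prop)).1 h2]

lemma iIndepFun_subtreeEnvironment {Ω : Type*} [MeasurableSpace Ω] {P : Measure Ω} {d : ℕ}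
    {β : Type*} [MeasurableSpace β] {X : TreeVertex d → Ω → β} (mX : ∀ u, Measurable (X u))
    (h : iIndepFun X P) :
    iIndepFun (fun (j : Fin d) ω => subtreeEnvironment (fun u => X u ω) j) P := by
  refine iIndepFun_curry (X := fun (j : Fin d) (u : TreeVertex d) ω => X (u ++ [j]) ω)
    (fun j u => mX _) ?_
  refine h.precomp (g := fun p : (_ : Fin d) × TreeVertex d => p.2 ++ [p.1]) ?_
  rintro ⟨j, u⟩ ⟨j', u'⟩ huu
  obtain ⟨h1, h2⟩ := List.append_inj' huu rfl
  simp only [List.cons.injEq, and_true] at h2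
  subst h1 h2
  rfl

lemma indepFun_root_subtreeEnvironment {Ω : Type*} [MeasurableSpace Ω] {P : Measure Ω} {d : ℕ}
    {β : Type*} [MeasurableSpace β] {X : TreeVertex d → Ω → β} (mX : ∀ u, Measurable (X u))
    (h : iIndepFun X P) :
    IndepFun (X []) (fun ω (j : Fin d) => subtreeEnvironment (fun u => X u ω) j) P := by
  have h1 : iIndepFun (fun (b : Bool) ω (u : {u : TreeVertex d // u.isEmpty = b}) => X u.1 ω) P := by
    refine iIndepFun_curry (X := fun (b : Bool) (u : {u : TreeVertex d // u.isEmpty = b}) ω =>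
      X u.1 ω) (fun b u => mX _) ?_
    exact h.precomp (Equiv.sigmaFiberEquiv (List.isEmpty (α := Fin d))).injective
  have h2 := h1.indepFun (i := true) (j := false) (by decide)
  have hφ : Measurable fun r : {u : TreeVertex d // u.isEmpty = true} → β => r ⟨[], rfl⟩ :=
    measurable_pi_apply _
  have hψ : Measurable fun (r : {u : TreeVertex d // u.isEmpty = false} → β) (j : Fin d)
      (u : TreeVertex d) => r ⟨u ++ [j], by simp⟩ :=
    measurable_pi_lambda _ fun j => measurable_pi_lambda _ fun u => measurable_pi_apply _
  exact h2.comp hφ hψ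

/-- The Laplace transform of `Zₙ` for an environment with measurable independent rows. -/
lemma lintegral_exp_neg_chaosZ {d : ℕ} {Ω Ω₀ : Type*} [MeasurableSpace Ω] [MeasurableSpace Ω₀]
    {P : Measure Ω} [IsProbabilityMeasure P] {ν : Measure Ω₀} [IsProbabilityMeasure ν]
    {η : Ω₀ → Matrix (Fin d) (Fin d) ℝ} (hm : ∀ i j, AEMeasurable (fun ω => η ω i j) ν)
    (h0 : ∀ i j, ∀ᵐ ω ∂ν, 0 ≤ η ω i j) (n : ℕ) :
    ∀ (α : Fin d) (X : TreeVertex d → Ω → Fin d → ℝ), (∀ u, Measurable (X u)) → iIndepFun X P →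
      (∀ u, IdentDistrib (X u) (fun ω j => η ω (vertexColour α u) j) P ν) → ∀ t : ℝ, 0 ≤ t →
      ∫⁻ ω, ENNReal.ofReal (Real.exp (-(t * chaosZ (rowEnvironment fun u => X u ω) n))) ∂P =
        ENNReal.ofReal (chaosLaplace ν η n α t) := by
  induction n with
  | zero =>
    intro α X _ _ _ t ht
    simp [chaosZ_zero, chaosLaplace, max_eq_left ht]
  | succ n ih =>
    intro α X mX hX hlaw t ht
    set Z : Fin d → Ω → ℝ := fun j ω =>
      chaosZ (rowEnvironment (subtreeEnvironment (fun u => X u ω) j)) n with hZ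
    have mS : ∀ j, Measurable fun ω => subtreeEnvironment (fun u => X u ω) j := fun j =>
      measurable_pi_lambda _ fun u => mX _
    have mZ : ∀ j, Measurable (Z j) := fun j =>
      (measurable_chaosZ_rowEnvironment n).comp (mS j)
    have mZ' : Measurable fun ω j => Z j ω := measurable_pi_lambda _ mZ
    have hZind : iIndepFun Z P :=
      (iIndepFun_subtreeEnvironment mX hX).comp
        (fun _ r => chaosZ (rowEnvironment r) n) fun _ => measurable_chaosZ_rowEnvironment n
    have hroot : IndepFun (X []) (fun ω j => Z j ω) P := by
      have h1 : Measurable fun (r : Fin d → TreeVertex d → Fin d → ℝ) (j : Fin d) =>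
          chaosZ (rowEnvironment (r j)) n :=
        measurable_pi_lambda _ fun j =>
          (measurable_chaosZ_rowEnvironment n).comp (measurable_pi_apply j)
      exact (indepFun_root_subtreeEnvironment mX hX).comp measurable_id h1
    have hZlaw : ∀ j s, 0 ≤ s → ∫⁻ ω, ENNReal.ofReal (Real.exp (-(s * Z j ω))) ∂P =
        ENNReal.ofReal (chaosLaplace ν η n j s) := by
      intro j s hs
      refine ih j (fun u => X (u ++ [j])) (fun u => mX _) ?_ (fun u => ?_) s hs
      · exact hX.precomp (List.append_left_injective [j])
      · have := hlaw (u ++ [j])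
        rwa [vertexColour_append_singleton] at this
    set Φ : (Fin d → ℝ) × (Fin d → ℝ) → ℝ≥0∞ := fun p =>
      ∏ j, ENNReal.ofReal (Real.exp (-(t * p.1 j * p.2 j))) with hΦ
    have mΦ : Measurable Φ := by fun_prop
    have hpos : ∀ᵐ x ∂(P.map (X [])), ∀ j, 0 ≤ x j := by
      have h1 : ∀ᵐ ω ∂P, ∀ j, 0 ≤ X [] ω j :=
        (hlaw []).symm.ae_snd (p := fun x : Fin d → ℝ => ∀ j, 0 ≤ x j)
          (measurableSet_le measurable_const measurable_id)
          (ae_all_iff.2 fun j => h0 _ j)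
      exact (ae_map_iff (mX []).aemeasurable
        (measurableSet_le measurable_const measurable_id)).2 h1
    have mL : Measurable fun x : Fin d → ℝ =>
        ENNReal.ofReal (∏ j, chaosLaplace ν η n j (t * x j)) := by
      refine Measurable.ennreal_ofReal (Finset.measurable_fun_prod _ fun j _ => ?_)
      exact (chaosLaplace_antitone hm h0 n j).measurable.comp
        (by fun_prop : Measurable fun x : Fin d → ℝ => t * x j)
    calc ∫⁻ ω, ENNReal.ofReal (Real.exp (-(t * chaosZ (rowEnvironment fun u => X u ω) (n + 1)))) ∂P
        = ∫⁻ ω, ENNReal.ofReal (Real.exp (-t)) * Φ (X [] ω, fun j => Z j ω) ∂P := by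
          refine lintegral_congr fun ω => ?_
          rw [chaosZ_rowEnvironment_succ, hΦ]
          simp only []
          rw [← ENNReal.ofReal_prod_of_nonneg fun j _ => (Real.exp_pos _).le, ← Real.exp_sum,
            ← ENNReal.ofReal_mul (Real.exp_pos _).le, ← Real.exp_add]
          congr 2
          rw [mul_add, Finset.mul_sum, Finset.sum_neg_distrib, mul_one, neg_add]
          simp only [mul_assoc, hZ]
      _ = ENNReal.ofReal (Real.exp (-t)) * ∫⁻ p, Φ p ∂(P.map fun ω => (X [] ω, fun j => Z j ω)) := by
          rw [lintegral_const_mul' _ _ ENNReal.ofReal_ne_top,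
            lintegral_map mΦ ((mX []).prodMk mZ')]
      _ = ENNReal.ofReal (Real.exp (-t)) *
            ∫⁻ x, ∫⁻ z, Φ (x, z) ∂(P.map fun ω j => Z j ω) ∂(P.map (X [])) := by
          rw [(indepFun_iff_map_prod_eq_prod_map_map (mX []).aemeasurable mZ'.aemeasurable).1 hroot,
            lintegral_prod _ mΦ.aemeasurable]
      _ = ENNReal.ofReal (Real.exp (-t)) *
            -- With the root row fixed at `x`, the subtree sums are independent, so the exponential
            -- factorises and the induction hypothesis applies at `t * x j`, nonnegative for almost
            -- every `x`.
            ∫⁻ x, ENNReal.ofReal (∏ j, chaosLaplace ν η n j (t * x j)) ∂(P.map (X [])) := by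
          congr 1
          refine lintegral_congr_ae (hpos.mono fun x hx => ?_)
          have m1 : Measurable fun z => Φ (x, z) := mΦ.comp measurable_prodMk_left
          have h1 : iIndepFun (fun j ω => ENNReal.ofReal (Real.exp (-(t * x j * Z j ω)))) P :=
            hZind.comp (fun j z => ENNReal.ofReal (Real.exp (-(t * x j * z))))
              fun j => by fun_prop
          simp only []
          rw [lintegral_map m1 mZ', hΦ]
          simp only []
          rw [lintegral_prod_eq_prod_lintegral_of_indepFun _ _ h1 fun j => by
              have := mZ j
              fun_prop,
            ENNReal.ofReal_prod_of_nonneg fun j _ => chaosLaplace_nonneg hm h0 n j _]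
          exact Finset.prod_congr rfl fun j _ => hZlaw j _ (mul_nonneg ht (hx j))
      _ = ENNReal.ofReal (Real.exp (-t)) *
            ∫⁻ ω, ENNReal.ofReal (∏ j, chaosLaplace ν η n j (t * η ω α j)) ∂ν := by
          rw [lintegral_map mL (mX [])]
          congr 1
          exact ((hlaw []).comp mL).lintegral_eq
      _ = _ := by
          rw [chaosLaplace, max_eq_left ht, ENNReal.ofReal_mul (Real.exp_pos _).le]
          congr 1
          refine (ofReal_integral_eq_lintegral_ofReal ?_ ?_).symm
          · exact integrable_prod_comp_mul hm (chaosLaplace_antitone hm h0 n)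
              (chaosLaplace_nonneg hm h0 n) (chaosLaplace_le_one hm h0 n) α t
          · exact ae_of_all _ fun ω => Finset.prod_nonneg fun j _ => chaosLaplace_nonneg hm h0 n j _

/-! ### Almost sure divergence of the partial sums -/

theorem IsColouredEdgeEnvironment.tendsto_chaosZ {d : ℕ} {Ω Ω₀ : Type*} [MeasurableSpace Ω]
    [MeasurableSpace Ω₀] {P : Measure Ω} [IsProbabilityMeasure P] {ν : Measure Ω₀}
    [IsProbabilityMeasure ν] {η : Ω₀ → Matrix (Fin d) (Fin d) ℝ}
    (hm : ∀ i j, AEMeasurable (fun ω => η ω i j) ν)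
    (hη_atom : ∀ i j, (∀ᵐ ω ∂ν, η ω i j = 0) ∨ (∀ᵐ ω ∂ν, 0 < η ω i j))
    (hη_reg : ∃ N : ℕ, ∀ x ∈ Set.Icc (0 : ℝ) 1, ∀ i j, 0 < (momentMatrix ν η x ^ N) i j)
    (hlam : 1 < chaosLambda ν η) {α : Fin d} {ξ : Ω → TreeVertex d → ℝ}
    (hξ : IsColouredEdgeEnvironment P ν η α ξ) :
    ∀ᵐ ω ∂P, Tendsto (chaosZ (ξ ω)) atTop atTop := by
  have h0 : ∀ i j, ∀ᵐ ω ∂ν, 0 ≤ η ω i j := fun i j => by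
    rcases hη_atom i j with h | h
    · exact h.mono fun ω hω => hω.ge
    · exact h.mono fun ω hω => hω.le
  have hae := fun u => (hξ.row_law u).aemeasurable_fst
  set X : TreeVertex d → Ω → Fin d → ℝ := fun u => (hae u).mk with hXdef
  have mX : ∀ u, Measurable (X u) := fun u => (hae u).measurable_mk
  have hXeq : ∀ u, (fun ω (j : Fin d) => ξ ω (j :: u)) =ᵐ[P] X u := fun u => (hae u).ae_eq_mk
  have hX : iIndepFun X P := (iIndepFun_congr hXeq).1 hξ.indep
  have hlaw : ∀ u, IdentDistrib (X u) (fun ω j => η ω (vertexColour α u) j) P ν := fun u =>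
    ((hae u).identDistrib_mk).symm.trans (hξ.row_law u)
  -- `f` plays the role of `e^{-Z}`; its integral lies below every transform at `t = 1`, so it
  -- vanishes and `f = 0` almost surely.
  set f : Ω → ℝ≥0∞ := fun ω => ⨅ n, ENNReal.ofReal
    (Real.exp (-(1 * chaosZ (rowEnvironment fun u => X u ω) n))) with hf
  have mf : Measurable f := by
    refine Measurable.iInf fun n => ?_
    have h1 : Measurable fun ω => chaosZ (rowEnvironment fun u => X u ω) n :=
      (measurable_chaosZ_rowEnvironment n).comp (measurable_pi_lambda _ mX)
    fun_prop
  have hf0 : ∫⁻ ω, f ω ∂P = 0 := by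
    have h1 : ∀ n, ∫⁻ ω, f ω ∂P ≤ ENNReal.ofReal (chaosLaplace ν η n α 1) := fun n => by
      rw [← lintegral_exp_neg_chaosZ hm h0 n α X mX hX hlaw 1 zero_le_one]
      exact lintegral_mono fun ω => iInf_le _ n
    have h2 : Tendsto (fun n => ENNReal.ofReal (chaosLaplace ν η n α 1)) atTop (nhds 0) := by
      have h3 := ENNReal.tendsto_ofReal (tendsto_chaosLaplace hm h0 α 1)
      rwa [chaosLaplaceLimit_eq_zero hm hη_atom hη_reg hlam α one_pos, ENNReal.ofReal_zero] at h3
    exact le_antisymm (ge_of_tendsto' h2 h1) zero_le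
  have hnonneg : ∀ᵐ ω ∂P, ∀ u j, 0 ≤ X u ω j := ae_all_iff.2 fun u =>
    (hlaw u).symm.ae_snd (p := fun x : Fin d → ℝ => ∀ j, 0 ≤ x j)
      (measurableSet_le measurable_const measurable_id) (ae_all_iff.2 fun j => h0 _ j)
  filter_upwards [(lintegral_eq_zero_iff mf).1 hf0, hnonneg, ae_all_iff.2 hXeq] with ω h1 h2 h3
  have hZ : chaosZ (ξ ω) = chaosZ (rowEnvironment fun u => X u ω) :=
    funext fun n => chaosZ_congr (fun j u => congrFun (h3 u) j) n
  rw [hZ]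
  refine tendsto_atTop_atTop_of_monotone (chaosZ_mono fun j u => h2 u j) fun M => ?_
  have h4 : f ω < ENNReal.ofReal (Real.exp (-M)) := by
    rw [h1]
    exact ENNReal.ofReal_pos.2 (Real.exp_pos _)
  obtain ⟨n, hn⟩ := iInf_lt_iff.1 h4
  rw [ENNReal.ofReal_lt_ofReal_iff (Real.exp_pos _), Real.exp_lt_exp] at hn
  exact ⟨n, by linarith⟩

/-! ### Invariant measures of the walk in a fixed environment -/

section

variable {d : ℕ} {p : TreeVertex d → Fin (d + 1) → ℝ}

lemma edgeRatio_cons_of_ne_nil (p : TreeVertex d → Fin (d + 1) → ℝ) (j : Fin d)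
    {v : TreeVertex d} (hv : v ≠ []) : edgeRatio p (j :: v) = p v j.succ / p v 0 := by
  cases v with
  | nil => exact absurd rfl hv
  | cons i u => rfl

lemma edgeRatio_nonneg (hp0 : ∀ v : TreeVertex d, v ≠ [] → 0 < p v 0)
    (hpn : ∀ (v : TreeVertex d) (j : Fin d), 0 ≤ p v j.succ) (j : Fin d) (u : TreeVertex d) :
    0 ≤ edgeRatio p (j :: u) := by
  cases u with
  | nil => exact hpn _ _
  | cons i u => exact div_nonneg (hpn _ _) (hp0 _ (List.cons_ne_nil _ _)).le

/-- The mass that the walk started from `π` moves into `v` from the parent of `v`. -/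
def massFromParent (p : TreeVertex d → Fin (d + 1) → ℝ) (π : TreeVertex d → ℝ) :
    TreeVertex d → ℝ
  | [] => 0
  | j :: u => π u * p u j.succ

/-- Only the neighbours of `v'` contribute, so invariance becomes a finite balance equation. -/
lemma hasSum_mul_treeTransition (p : TreeVertex d → Fin (d + 1) → ℝ) (π : TreeVertex d → ℝ)
    (v' : TreeVertex d) :
    HasSum (fun v => π v * treeTransition p v v')
      (massFromParent p π v' + ∑ i, π (i :: v') * p (i :: v') 0) := by
  have h1 : HasSum (fun v => ∑ j : Fin d, if v' = j :: v then π v * p v j.succ else 0)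
      (massFromParent p π v') := by
    cases v' with
    | nil => simp [massFromParent]
    | cons j u =>
      have h2 : (fun v => ∑ i : Fin d, if j :: u = i :: v then π v * p v i.succ else 0) =
          fun v => if v = u then π u * p u j.succ else 0 := by
        funext v
        by_cases hv : v = u
        · subst hv
          rw [Finset.sum_eq_single j (fun i _ hi => by simp [hi.symm]) (by simp)]
          simp
        · simp [hv, Ne.symm hv]
      rw [h2]
      exact hasSum_ite_eq u _
  have h3 : HasSum (fun v => ∑ i : Fin d, if v = i :: v' then π (i :: v') * p (i :: v') 0 else 0)
      (∑ i, π (i :: v') * p (i :: v') 0) :=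
    hasSum_sum fun i _ => hasSum_ite_eq _ _
  convert h1.add h3 using 1
  funext v
  rw [treeTransition, mul_add, Finset.mul_sum, Finset.mul_sum]
  congr 1
  · exact Finset.sum_congr rfl fun j _ => by split_ifs <;> simp
  · refine Finset.sum_congr rfl fun i _ => ?_
    split_ifs with h
    · rw [h]
    · simp

lemma isInvariantMeasure_iff {π : TreeVertex d → ℝ} :
    IsInvariantMeasure p π ↔ (∀ v, 0 ≤ π v) ∧
      ∀ v, massFromParent p π v + ∑ i, π (i :: v) * p (i :: v) 0 = π v := by
  refine and_congr_right fun _ => forall_congr' fun v => ⟨fun h => ?_, fun h => ?_⟩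
  · exact (hasSum_mul_treeTransition p π v).unique h
  · rw [← h]
    exact hasSum_mul_treeTransition p π v

/-- Detailed balance along each edge, from which invariance follows. -/
lemma chaosMeasure_mul_inward (hp0 : ∀ v : TreeVertex d, v ≠ [] → 0 < p v 0) (c : ℝ)
    (j : Fin d) (u : TreeVertex d) :
    chaosMeasure p c (j :: u) * p (j :: u) 0 = chaosMeasure p c u * p u j.succ := by
  have h1 := (hp0 (j :: u) (List.cons_ne_nil _ _)).ne'
  have h2 : chaosMeasure p c (j :: u) * p (j :: u) 0 =
      c * pathWeight (edgeRatio p) (j :: u) := by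
    rw [chaosMeasure]
    field_simp
  rw [h2, pathWeight]
  cases u with
  | nil => simp [pathWeight, edgeRatio, chaosMeasure]
  | cons i w =>
    rw [edgeRatio_cons_of_ne_nil p j (List.cons_ne_nil i w), chaosMeasure]
    ring

lemma chaosMeasure_nonneg (hp0 : ∀ v : TreeVertex d, v ≠ [] → 0 < p v 0)
    (hpn : ∀ (v : TreeVertex d) (j : Fin d), 0 ≤ p v j.succ) {c : ℝ} (hc : 0 ≤ c)
    (v : TreeVertex d) : 0 ≤ chaosMeasure p c v := by
  cases v with
  | nil => exact hc
  | cons j u =>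
    exact mul_nonneg (mul_nonneg hc (pathWeight_nonneg (edgeRatio_nonneg hp0 hpn) _))
      (one_div_nonneg.2 (hp0 _ (List.cons_ne_nil _ _)).le)

lemma isInvariantMeasure_chaosMeasure (hp0 : ∀ v : TreeVertex d, v ≠ [] → 0 < p v 0)
    (hpn : ∀ (v : TreeVertex d) (j : Fin d), 0 ≤ p v j.succ)
    (hs : ∀ v : TreeVertex d, v ≠ [] → ∑ j, p v j = 1) (hr : ∑ j : Fin d, p [] j.succ = 1)
    {c : ℝ} (hc : 0 ≤ c) : IsInvariantMeasure p (chaosMeasure p c) := by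
  refine isInvariantMeasure_iff.2 ⟨chaosMeasure_nonneg hp0 hpn hc, fun v => ?_⟩
  simp_rw [chaosMeasure_mul_inward hp0, ← Finset.mul_sum]
  cases v with
  | nil => rw [hr, massFromParent, mul_one, zero_add]
  | cons j u =>
    have h := hs (j :: u) (List.cons_ne_nil _ _)
    rw [Fin.sum_univ_succ] at h
    rw [massFromParent, ← chaosMeasure_mul_inward hp0, ← mul_add, h, mul_one]

lemma inward_le_one (hpn : ∀ (v : TreeVertex d) (j : Fin d), 0 ≤ p v j.succ)
    (hs : ∀ v : TreeVertex d, v ≠ [] → ∑ j, p v j = 1) {v : TreeVertex d} (hv : v ≠ []) :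
    p v 0 ≤ 1 := by
  have h := hs v hv
  rw [Fin.sum_univ_succ] at h
  linarith [Finset.sum_nonneg fun j (_ : j ∈ Finset.univ) => hpn v j]

lemma outward_sum_le_one (hp0 : ∀ v : TreeVertex d, v ≠ [] → 0 < p v 0)
    (hs : ∀ v : TreeVertex d, v ≠ [] → ∑ j, p v j = 1) (hr : ∑ j : Fin d, p [] j.succ = 1)
    (v : TreeVertex d) : ∑ j : Fin d, p v j.succ ≤ 1 := by
  by_cases hv : v = []
  · rw [hv, hr]
  · have h := hs v hv
    rw [Fin.sum_univ_succ] at h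
    linarith [hp0 v hv]

lemma summable_sigma_vector {f : TreeVertex d → ℝ} (hf : Summable f) :
    Summable fun q : (n : ℕ) × List.Vector (Fin d) n => f q.2.toList :=
  hf.comp_injective (Equiv.sigmaFiberEquiv (List.length (α := Fin d))).injective

/-- Since `1 / p v 0 ≥ 1`, the measure dominates `c · ξ[v]`, and a finite sum of the latter would
bound `Z_n`. -/
lemma not_summable_chaosMeasure (hp0 : ∀ v : TreeVertex d, v ≠ [] → 0 < p v 0)
    (hpn : ∀ (v : TreeVertex d) (j : Fin d), 0 ≤ p v j.succ)
    (hs : ∀ v : TreeVertex d, v ≠ [] → ∑ j, p v j = 1)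
    (hZ : Tendsto (chaosZ (edgeRatio p)) atTop atTop) {c : ℝ} (hc : 0 < c) :
    ¬ Summable (chaosMeasure p c) := by
  intro hsum
  have hw0 : ∀ v, 0 ≤ pathWeight (edgeRatio p) v := pathWeight_nonneg (edgeRatio_nonneg hp0 hpn)
  have hle : ∀ v, c * pathWeight (edgeRatio p) v ≤ chaosMeasure p c v := by
    intro v
    cases v with
    | nil => simp [pathWeight, chaosMeasure]
    | cons j u =>
      refine le_mul_of_one_le_right (mul_nonneg hc.le (hw0 _)) ?_
      rw [le_div_iff₀ (hp0 _ (List.cons_ne_nil _ _)), one_mul]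
      exact inward_le_one hpn hs (List.cons_ne_nil _ _)
  have h1 : Summable (pathWeight (edgeRatio p)) :=
    (summable_mul_left_iff hc.ne').1
      (Summable.of_nonneg_of_le (fun v => mul_nonneg hc.le (hw0 v)) hle hsum)
  have h2 := summable_sigma_vector h1
  obtain ⟨n, hn⟩ := (hZ.eventually_gt_atTop
    (∑' q : (n : ℕ) × List.Vector (Fin d) n, pathWeight (edgeRatio p) q.2.toList)).exists
  refine hn.not_ge ?_
  unfold chaosZ chaosY
  rw [Finset.sum_sigma' (Finset.range (n + 1)) fun k => (Finset.univ :
    Finset (List.Vector (Fin d) k))]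
  exact h2.sum_le_tsum _ fun q _ => hw0 _

/-- The net flow of an invariant measure of finite mass vanishes along every edge. -/
lemma IsInvariantMeasure.flow_eq_zero (hp0 : ∀ v : TreeVertex d, v ≠ [] → 0 < p v 0)
    (hpn : ∀ (v : TreeVertex d) (j : Fin d), 0 ≤ p v j.succ)
    (hs : ∀ v : TreeVertex d, v ≠ [] → ∑ j, p v j = 1) (hr : ∑ j : Fin d, p [] j.succ = 1)
    {π : TreeVertex d → ℝ} (hπ : IsInvariantMeasure p π) (hsum : Summable π) (j : Fin d)
    (u : TreeVertex d) : π u * p u j.succ = π (j :: u) * p (j :: u) 0 := by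
  obtain ⟨hπ0, hinv⟩ := isInvariantMeasure_iff.1 hπ
  set F : Fin d → TreeVertex d → ℝ := fun j u => π u * p u j.succ - π (j :: u) * p (j :: u) 0
    with hF
  -- Conservation: the net flow into a vertex from its parent leaves through its children. Hence the
  -- total absolute flow `Φ` through a level cannot decrease with depth, while summability forces it
  -- to tend to `0`.
  have hFsucc : ∀ j u, F j u = ∑ i, F i (j :: u) := by
    intro j u
    have h1 := hinv (j :: u)
    have h2 := hs (j :: u) (List.cons_ne_nil _ _)
    rw [Fin.sum_univ_succ] at h2
    rw [massFromParent] at h1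
    simp only [hF, Finset.sum_sub_distrib, ← Finset.mul_sum]
    have h3 : ∑ i : Fin d, p (j :: u) i.succ = 1 - p (j :: u) 0 := by linarith
    rw [h3]
    linarith
  set mass : ℕ → ℝ := fun n => ∑ v : List.Vector (Fin d) n, π v.toList with hmass
  have hmass0 : Tendsto mass atTop (nhds 0) := by
    have h1 := (summable_sigma_vector hsum).sigma.tendsto_atTop_zero
    simpa [tsum_fintype] using h1
  set Φ : ℕ → ℝ := fun n => ∑ v : List.Vector (Fin d) n, ∑ j, |F j v.toList| with hΦ
  have hΦmono : Monotone Φ := by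
    refine monotone_nat_of_le_succ fun n => ?_
    simp only [hΦ]
    rw [sum_vector_succ_cons fun v => ∑ j, |F j v|, Finset.sum_comm]
    refine Finset.sum_le_sum fun j _ => Finset.sum_le_sum fun v _ => ?_
    rw [hFsucc]
    exact Finset.abs_sum_le_sum_abs _ _
  have hΦle : ∀ n, Φ n ≤ mass n + mass (n + 1) := by
    intro n
    calc Φ n ≤ ∑ v : List.Vector (Fin d) n, ∑ j, (π v.toList * p v.toList j.succ +
          π (j :: v.toList)) := by
          refine Finset.sum_le_sum fun v _ => Finset.sum_le_sum fun j _ => ?_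
          have h1 := mul_nonneg (hπ0 v.toList) (hpn v.toList j)
          have h2 := mul_nonneg (hπ0 (j :: v.toList)) (hp0 (j :: v.toList) (List.cons_ne_nil _ _)).le
          have h3 : π (j :: v.toList) * p (j :: v.toList) 0 ≤ π (j :: v.toList) :=
            mul_le_of_le_one_right (hπ0 _) (inward_le_one hpn hs (List.cons_ne_nil _ _))
          rw [abs_le]
          constructor <;> simp only [hF] <;> linarith
      _ = ∑ v : List.Vector (Fin d) n, π v.toList * ∑ j : Fin d, p v.toList j.succ +
          mass (n + 1) := by
          simp only [hmass]
          rw [sum_vector_succ_cons π, Finset.sum_comm (s := Finset.univ (α := Fin d)),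
            ← Finset.sum_add_distrib]
          exact Finset.sum_congr rfl fun v _ => by rw [Finset.sum_add_distrib, Finset.mul_sum]
      _ ≤ _ := by
          refine add_le_add_left (Finset.sum_le_sum fun v _ => ?_) _
          exact mul_le_of_le_one_right (hπ0 _) (outward_sum_le_one hp0 hs hr _)
  have hlim : Tendsto (fun n => mass n + mass (n + 1)) atTop (nhds 0) := by
    simpa using hmass0.add (hmass0.comp (tendsto_add_atTop_nat 1))
  have hΦ0 : Φ u.length ≤ 0 := by
    refine ge_of_tendsto hlim ((eventually_ge_atTop u.length).mono fun n hn => ?_)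
    exact (hΦmono hn).trans (hΦle n)
  have h1 : |F j u| ≤ Φ u.length := by
    let w : List.Vector (Fin d) u.length := ⟨u, rfl⟩
    calc |F j u| ≤ ∑ j, |F j u| :=
          Finset.single_le_sum (fun i _ => abs_nonneg (F i u)) (Finset.mem_univ j)
      _ ≤ Φ u.length := Finset.single_le_sum
          (f := fun v : List.Vector (Fin d) u.length => ∑ j, |F j v.toList|)
          (fun v _ => Finset.sum_nonneg fun i _ => abs_nonneg _)
          (Finset.mem_univ w)
  have h2 : F j u = 0 := abs_nonpos_iff.1 (h1.trans hΦ0)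
  exact sub_eq_zero.1 h2

/-- Zero flow is detailed balance, which determines `π` from its value at the root: it is `0` or has
infinite mass. -/
lemma not_isErgodicWalk (hp0 : ∀ v : TreeVertex d, v ≠ [] → 0 < p v 0)
    (hpn : ∀ (v : TreeVertex d) (j : Fin d), 0 ≤ p v j.succ)
    (hs : ∀ v : TreeVertex d, v ≠ [] → ∑ j, p v j = 1) (hr : ∑ j : Fin d, p [] j.succ = 1)
    (hZ : Tendsto (chaosZ (edgeRatio p)) atTop atTop) : ¬ IsErgodicWalk p := by
  rintro ⟨π, hπ, hsum⟩
  have hflow := hπ.flow_eq_zero hp0 hpn hs hr hsum.summable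
  have heq : ∀ v, π v = chaosMeasure p (π []) v := by
    intro v
    induction v with
    | nil => rfl
    | cons j u ih =>
      have h1 := (hp0 (j :: u) (List.cons_ne_nil _ _)).ne'
      refine mul_right_cancel₀ h1 ?_
      rw [← hflow, chaosMeasure_mul_inward hp0, ← ih]
  rcases (hπ.1 []).eq_or_lt with h0 | h0
  · have h1 : ∀ v, π v = 0 := by
      intro v
      rw [heq v, ← h0]
      cases v <;> simp [chaosMeasure]
    have h2 : π = fun _ => 0 := funext h1
    rw [h2] at hsum
    exact zero_ne_one (hasSum_zero.unique hsum)
  · refine not_summable_chaosMeasure hp0 hpn hs hZ h0 ?_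
    rw [← show π = chaosMeasure p (π []) from funext heq]
    exact hsum.summable

/-- The root's row need not follow the law of a row of `η`, so divergence is taken from the subtree
of one child that the root reaches with positive probability. -/
lemma tendsto_chaosZ_edgeRatio (hp0 : ∀ v : TreeVertex d, v ≠ [] → 0 < p v 0)
    (hpn : ∀ (v : TreeVertex d) (j : Fin d), 0 ≤ p v j.succ) (hr : ∑ j : Fin d, p [] j.succ = 1)
    (h : ∀ j, Tendsto (chaosZ (subtreeEnvironment (edgeRatio p) j)) atTop atTop) :
    Tendsto (chaosZ (edgeRatio p)) atTop atTop := by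
  obtain ⟨j₀, -, hj₀⟩ : ∃ j ∈ Finset.univ, (0 : ℝ) < p [] (Fin.succ j) := by
    by_contra! hneg
    have := Finset.sum_nonpos hneg
    linarith
  rw [← tendsto_add_atTop_iff_nat 1]
  refine tendsto_atTop_mono (fun n => ?_) ((h j₀).const_mul_atTop hj₀)
  rw [chaosZ_succ]
  have h1 : ∀ j ∈ Finset.univ, 0 ≤ edgeRatio p [j] * chaosZ (subtreeEnvironment (edgeRatio p) j) n := by
    intro j _
    refine mul_nonneg (hpn _ _) (Finset.sum_nonneg fun k _ => Finset.sum_nonneg fun v _ => ?_)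
    exact pathWeight_nonneg (fun i u => edgeRatio_nonneg hp0 hpn i (u ++ [j])) _
  have h2 := Finset.single_le_sum h1 (Finset.mem_univ j₀)
  have h3 : edgeRatio p [j₀] = p [] j₀.succ := rfl
  rw [h3] at h2
  linarith

end

/-! ### From the random walk environment to the chaos -/

lemma IsColouredWalkEnvironment.isColouredEdgeEnvironment {d : ℕ} {Ω Ω₀ : Type*}
    [MeasurableSpace Ω] [MeasurableSpace Ω₀] {P : Measure Ω} {ν : Measure Ω₀}
    {η : Ω₀ → Matrix (Fin d) (Fin d) ℝ} {α : Fin d} {p : Ω → TreeVertex d → Fin (d + 1) → ℝ}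
    (hp : IsColouredWalkEnvironment P ν η α p) (j : Fin d) :
    IsColouredEdgeEnvironment P ν η j fun ω => subtreeEnvironment (edgeRatio (p ω)) j := by
  have hne : ∀ u : TreeVertex d, u ++ [j] ≠ [] := fun u => by simp
  have heq : ∀ u : TreeVertex d,
      (fun ω (i : Fin d) => subtreeEnvironment (edgeRatio (p ω)) j (i :: u)) =
        fun ω i => p ω (u ++ [j]) i.succ / p ω (u ++ [j]) 0 := fun u => by
    funext ω i
    exact edgeRatio_cons_of_ne_nil _ _ (hne u)
  refine ⟨fun u => ?_, ?_⟩
  · rw [heq, ← vertexColour_append_singleton α]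
    exact hp.ratio_law _ (hne u)
  · rw [show (fun (u : TreeVertex d) ω (i : Fin d) =>
        subtreeEnvironment (edgeRatio (p ω)) j (i :: u)) = _ from funext heq]
    have h1 := hp.indep.precomp (g := fun u : TreeVertex d =>
      (⟨u ++ [j], hne u⟩ : {v : TreeVertex d // v ≠ []})) fun u u' h =>
        List.append_left_injective [j] (congrArg Subtype.val h)
    have h2 : Measurable fun (x : Fin (d + 1) → ℝ) (i : Fin d) => x i.succ / x 0 := by fun_prop
    exact h1.comp (fun _ (x : Fin (d + 1) → ℝ) (i : Fin d) => x i.succ / x 0) fun _ => h2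

theorem mainTheorem3 {d : ℕ} {Ω Ω₀ : Type*} [MeasurableSpace Ω] [MeasurableSpace Ω₀]
    (P : Measure Ω) [IsProbabilityMeasure P] (ν : Measure Ω₀) [IsProbabilityMeasure ν]
    (η : Ω₀ → Matrix (Fin d) (Fin d) ℝ)
    (hη_int : ∀ i j, Integrable (fun ω => η ω i j) ν)
    (hη_atom : ∀ i j, (∀ᵐ ω ∂ν, η ω i j = 0) ∨ (∀ᵐ ω ∂ν, 0 < η ω i j))
    (hη_reg : ∃ N : ℕ, ∀ x ∈ Set.Icc (0 : ℝ) 1, ∀ i j, 0 < (momentMatrix ν η x ^ N) i j)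
    (hlam : 1 < chaosLambda ν η)
    (α : Fin d) :
    (∀ ξ : Ω → TreeVertex d → ℝ, IsColouredEdgeEnvironment P ν η α ξ →
      ∀ᵐ ω ∂P, Tendsto (chaosZ (ξ ω)) atTop atTop) ∧
    (∀ p : Ω → TreeVertex d → Fin (d + 1) → ℝ, IsColouredWalkEnvironment P ν η α p →
      ∀ᵐ ω ∂P, Tendsto (chaosZ (edgeRatio (p ω))) atTop atTop ∧
        (∀ c : ℝ, 0 < c → IsInvariantMeasure (p ω) (chaosMeasure (p ω) c) ∧
          ¬ Summable (chaosMeasure (p ω) c)) ∧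
        ¬ IsErgodicWalk (p ω)) := by
  have hm : ∀ i j, AEMeasurable (fun ω => η ω i j) ν := fun i j => (hη_int i j).aemeasurable
  refine ⟨fun ξ hξ => hξ.tendsto_chaosZ hm hη_atom hη_reg hlam, fun p hp => ?_⟩
  have hsub := ae_all_iff.2 fun j =>
    (hp.isColouredEdgeEnvironment j).tendsto_chaosZ hm hη_atom hη_reg hlam
  filter_upwards [hsub, hp.inward_pos, hp.outward_nonneg, hp.sum_eq_one, hp.root_sum_eq_one]
    with ω hω hp0 hpn hs hr
  have hZ := tendsto_chaosZ_edgeRatio hp0 hpn hr hω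
  exact ⟨hZ, fun c hc => ⟨isInvariantMeasure_chaosMeasure hp0 hpn hs hr hc.le,
    not_summable_chaosMeasure hp0 hpn hs hZ hc⟩, not_isErgodicWalk hp0 hpn hs hr hZ⟩
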